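/- A strided difference bound matrix (SDBM) over integer variables $x_1,\dots,x_n$ is a system of finitely many difference bounds $-x_i+x_j\le c$, $(i,j,c)\in E\subseteq[n]\times[n]\times\mathbb Z$, of optional variable bounds $\ell_i\le x_i$, $x_i\le u_i$, and of one congruence $x_i\equiv r_i \pmod{d_i}$ with $d_i\neq 0$ for each $i$. Put $D=\operatorname{lcm}(d_1,\dots,d_n)$. It is simple if it has no variable bounds and all $r_i=0$. Write $\lfloor x\rfloor_d$ for $x$ rounded down to a multiple of $d$. On a simple SDBM, SolveSDBM looks for an integral solution $p$ of the difference bounds and returns $\bot$ if there is none. Otherwise it computes $D$, sets $\ell_i:=p_i-nD$ and $u_i:=\lfloor p_i+nD\rfloor_{d_i}$ for all $i$, and propagates upper bounds: for a constraint $(i,j,c)\in E$ with $\lfloor u_i+c\rfloor_{d_j}<u_j$ it sets $u_j:=\lfloor u_i+c\rfloor_{d_j}$, and returns $\bot$ if now $u_j<\ell_j$. When no constraint changes $u$ any more, it returns $u$. The sweep version repeatedly goes through all constraints of $E$. The worklist version keeps a set of dirty variables, initially all of them; it repeatedly removes an arbitrary dirty variable $i$, processes the constraints $(i,j,c)\in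 E$ with source $i$, and makes $j$ dirty whenever $u_j$ decreases. Running times are counted on a random access machine that performs every integer arithmetic operation, comparison, assignment and array access in unit time; they include the computation of $p$ (by Bellman–Ford relaxation) and of $D$ (by Euclid's algorithm). Theorem. (1) On every simple SDBM, for every order of the constraints and every choice of dirty variables, both versions of SolveSDBM halt. They return a solution of the SDBM if it is satisfiable and $\bot$ if it is not. If $m=|E|\ge 1$, the sweep version takes $O(n^2mD)$ steps and the worklist version takes $O(nmD)$ steps. (2) The same holds for the part of the algorithm that follows the choice of $p$, for every integral solution $p$ of the difference bounds; and a returned solution $u$ then satisfies $|u_i-p_i|\le nD$ for all $i$. (3) For an arbitrary SDBM, use the following reduction: shift the remainders to $0$, replace the variable bounds by difference bounds against one new variable $x_0\equiv 0\pmod D$, run SolveSDBM on the resulting simple SDBM, and translate a returned solution back. This procedure, in both versions, always halts; it returns a solution of the given SDBM if it is satisfiable and $\bot$ if it is not. If $m\ge 1$ is the number of difference bounds and variable bounds together, it takes $O(n^2mD)$ steps in the sweep version and $O(nmD)$ steps in the worklist version. The constants in the $O$-bounds are absolute. -/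

import Mathlib

/-! ## Strided difference bound matrices -/

/-- A difference bound matrix over variables indexed by `Fin n`: the triple `(i, j, c) ∈ E` is the
constraint `-x i + x j ≤ c`; a variable bound that is absent is `none`. -/
structure DBM (n : ℕ) where
  E : Finset (Fin n × Fin n × ℤ)
  lower : Fin n → Option ℤ
  upper : Fin n → Option ℤ

/-- The integral solutions of a DBM. -/
def DBM.IsSolution {n : ℕ} (B : DBM n) (x : Fin n → ℤ) : Prop :=
  (∀ i j : Fin n, ∀ c : ℤ, (i, j, c) ∈ B.E → -x i + x j ≤ c) ∧
  (∀ i : Fin n, ∀ l ∈ B.lower i, l ≤ x i) ∧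
  (∀ i : Fin n, ∀ u ∈ B.upper i, x i ≤ u)

/-- The number of inequalities of a DBM: difference bounds and variable bounds that are present. -/
def DBM.numIneqs {n : ℕ} (B : DBM n) : ℕ :=
  B.E.card + (Finset.univ.filter fun i => (B.lower i).isSome).card
    + (Finset.univ.filter fun i => (B.upper i).isSome).card

/-- A strided DBM: a DBM with the congruences `x i ≡ r i (mod d i)`. -/
structure SDBM (n : ℕ) extends DBM n where
  d : Fin n → ℤ
  r : Fin n → ℤ

namespace SDBM

def IsSolution {n : ℕ} (S : SDBM n) (x : Fin n → ℤ) : Prop :=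
  S.toDBM.IsSolution x ∧ ∀ i : Fin n, x i ≡ S.r i [ZMOD S.d i]

def Satisfiable {n : ℕ} (S : SDBM n) : Prop := ∃ x : Fin n → ℤ, S.IsSolution x

/-- No variable bounds, and all remainders are zero. -/
def IsSimple {n : ℕ} (S : SDBM n) : Prop :=
  (∀ i, S.lower i = none) ∧ (∀ i, S.upper i = none) ∧ (∀ i, S.r i = 0)

/-- The least common multiple of the congruence divisors. -/
def lcmDiv {n : ℕ} (S : SDBM n) : ℕ := Finset.univ.lcm fun i => (S.d i).natAbs

end SDBM

/-! ## A unit-cost random access machine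

Imperative programs over integer registers and integer arrays. Every literal, register access,
array access, arithmetic operation, comparison, assignment, and branch costs one step. -/

namespace RAM

/-- Names of the integer registers. -/
inductive Reg
  | n | m | i | j | k | e | a | b | t | lcm | sat | changed | top
  deriving DecidableEq

/-- Names of the integer arrays. -/
inductive Arr
  | src | dst | wt | d | r | hasLo | loBd | hasHi | hiBd
  | p | lo | up | head | next | pool | inDirty | out
  deriving DecidableEq

/-- The memory. `choices` is a stream that resolves the nondeterministic choices of a program. -/
structure Store where
  reg : Reg → ℤ
  arr : Arr → ℤ → ℤ
  choices : ℕ → ℕ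

def Store.setReg (σ : Store) (x : Reg) (v : ℤ) : Store :=
  { σ with reg := Function.update σ.reg x v }

def Store.setArr (σ : Store) (A : Arr) (k v : ℤ) : Store :=
  { σ with arr := Function.update σ.arr A (Function.update (σ.arr A) k v) }

inductive Expr
  | lit (z : ℤ)
  | reg (x : Reg)
  | get (A : Arr) (idx : Expr)
  | add (e f : Expr)
  | sub (e f : Expr)
  | mul (e f : Expr)
  | div (e f : Expr)
  | mod (e f : Expr)

namespace Expr

instance : Coe Reg Expr := ⟨Expr.reg⟩
instance (k : ℕ) : OfNat Expr k := ⟨Expr.lit k⟩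
instance : Add Expr := ⟨Expr.add⟩
instance : Sub Expr := ⟨Expr.sub⟩
instance : Mul Expr := ⟨Expr.mul⟩
instance : Div Expr := ⟨Expr.div⟩
instance : Mod Expr := ⟨Expr.mod⟩

/-- The value of an expression. Division and remainder are Euclidean: the remainder is
nonnegative, so `f * (e / f)` is `e` rounded down to a multiple of `f` whenever `f` is nonzero. -/
def eval (σ : Store) : Expr → ℤ
  | lit z => z
  | reg x => σ.reg x
  | get A idx => σ.arr A (idx.eval σ)
  | add e f => e.eval σ + f.eval σ
  | sub e f => e.eval σ - f.eval σ
  | mul e f => e.eval σ * f.eval σ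
  | div e f => e.eval σ / f.eval σ
  | mod e f => e.eval σ % f.eval σ

def cost : Expr → ℕ
  | lit _ => 1
  | reg _ => 1
  | get _ idx => idx.cost + 1
  | add e f => e.cost + f.cost + 1
  | sub e f => e.cost + f.cost + 1
  | mul e f => e.cost + f.cost + 1
  | div e f => e.cost + f.cost + 1
  | mod e f => e.cost + f.cost + 1

end Expr

inductive Cond
  | lt (e f : Expr)
  | eq (e f : Expr)
  | ne (e f : Expr)
  | and (c c' : Cond)

namespace Cond

def Holds (σ : Store) : Cond → Prop
  | lt e f => e.eval σ < f.eval σ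
  | eq e f => e.eval σ = f.eval σ
  | ne e f => e.eval σ ≠ f.eval σ
  | and c c' => c.Holds σ ∧ c'.Holds σ

def cost : Cond → ℕ
  | lt e f => e.cost + f.cost + 1
  | eq e f => e.cost + f.cost + 1
  | ne e f => e.cost + f.cost + 1
  | and c c' => c.cost + c'.cost + 1

end Cond

inductive Stmt
  | skip
  | set (x : Reg) (e : Expr)
  | store (A : Arr) (idx e : Expr)
  /-- put an arbitrary natural number below `e` into `x` -/
  | pick (x : Reg) (e : Expr)
  | seq (s s' : Stmt)
  | ite (c : Cond) (s s' : Stmt)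
  | loop (c : Cond) (s : Stmt)

/-- `Exec s σ t τ`: from memory `σ`, the program `s` halts after exactly `t` steps with
memory `τ`. -/
inductive Exec : Stmt → Store → ℕ → Store → Prop
  | skip (σ : Store) : Exec .skip σ 1 σ
  | set (x : Reg) (e : Expr) (σ : Store) :
      Exec (.set x e) σ (e.cost + 1) (σ.setReg x (e.eval σ))
  | store (A : Arr) (idx e : Expr) (σ : Store) :
      Exec (.store A idx e) σ (idx.cost + e.cost + 1) (σ.setArr A (idx.eval σ) (e.eval σ))
  | pick (x : Reg) (e : Expr) (σ : Store) :
      Exec (.pick x e) σ (e.cost + 1)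
        { σ.setReg x ((σ.choices 0 : ℤ) % e.eval σ) with choices := fun k => σ.choices (k + 1) }
  | seq {s s' : Stmt} {σ τ υ : Store} {t t' : ℕ} :
      Exec s σ t τ → Exec s' τ t' υ → Exec (.seq s s') σ (t + t') υ
  | iteTrue {c : Cond} {s s' : Stmt} {σ τ : Store} {t : ℕ} :
      c.Holds σ → Exec s σ t τ → Exec (.ite c s s') σ (c.cost + 1 + t) τ
  | iteFalse {c : Cond} {s s' : Stmt} {σ τ : Store} {t : ℕ} :
      ¬ c.Holds σ → Exec s' σ t τ → Exec (.ite c s s') σ (c.cost + 1 + t) τ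
  | loopTrue {c : Cond} {s : Stmt} {σ τ υ : Store} {t t' : ℕ} :
      c.Holds σ → Exec s σ t τ → Exec (.loop c s) τ t' υ →
      Exec (.loop c s) σ (c.cost + 1 + t + t') υ
  | loopFalse {c : Cond} {s : Stmt} {σ : Store} :
      ¬ c.Holds σ → Exec (.loop c s) σ (c.cost + 1) σ

/-- An execution is determined by the initial memory (which includes the choices), so that the
existence of a halting execution says that the one run of the program halts. -/
theorem Exec.deterministic {s : Stmt} {σ τ τ' : Store} {t t' : ℕ}
    (h : Exec s σ t τ) (h' : Exec s σ t' τ') : t = t' ∧ τ = τ' := by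
  induction h generalizing t' τ' with
  | skip => cases h'; exact ⟨rfl, rfl⟩
  | set => cases h'; exact ⟨rfl, rfl⟩
  | store => cases h'; exact ⟨rfl, rfl⟩
  | pick => cases h'; exact ⟨rfl, rfl⟩
  | seq _ _ ih₁ ih₂ =>
    cases h' with
    | seq k₁ k₂ =>
      obtain ⟨rfl, rfl⟩ := ih₁ k₁
      obtain ⟨rfl, rfl⟩ := ih₂ k₂
      exact ⟨rfl, rfl⟩
  | iteTrue hc _ ih =>
    cases h' with
    | iteTrue _ k => obtain ⟨rfl, rfl⟩ := ih k; exact ⟨rfl, rfl⟩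
    | iteFalse hn _ => exact absurd hc hn
  | iteFalse hn _ ih =>
    cases h' with
    | iteTrue hc _ => exact absurd hc hn
    | iteFalse _ k => obtain ⟨rfl, rfl⟩ := ih k; exact ⟨rfl, rfl⟩
  | loopTrue hc _ _ ih₁ ih₂ =>
    cases h' with
    | loopTrue _ k₁ k₂ =>
      obtain ⟨rfl, rfl⟩ := ih₁ k₁
      obtain ⟨rfl, rfl⟩ := ih₂ k₂
      exact ⟨rfl, rfl⟩
    | loopFalse hn => exact absurd hc hn
  | loopFalse hn =>
    cases h' with
    | loopTrue hc _ _ => exact absurd hc hn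
    | loopFalse _ => exact ⟨rfl, rfl⟩

infixr:30 " ;; " => Stmt.seq
infix:35 " ::= " => Stmt.set

/-- `for x = 0, …, bound - 1 do body`. -/
def Stmt.forBelow (x : Reg) (bound : Expr) (body : Stmt) : Stmt :=
  x ::= 0 ;; Stmt.loop (.lt x bound) (body ;; x ::= (x : Expr) + 1)

end RAM

/-! ## The algorithms -/

namespace SolveSDBM

open RAM RAM.Stmt RAM.Expr

/-- Rounding `x` down to a multiple of `y`. -/
def roundDown (x y : Expr) : Expr := y * (x / y)

/-- Bellman-Ford relaxation from the zero vector. Sets `sat` to `1` and stores an integral solution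
of the difference bounds in `p` if there is one; sets `sat` to `0` otherwise. -/
def findIntegral : Stmt :=
  forBelow .i Reg.n (store .p Reg.i 0) ;;
  forBelow .k Reg.n
    (forBelow .e Reg.m
      (.t ::= get .p (get .src Reg.e) + get .wt Reg.e ;;
       ite (.lt Reg.t (get .p (get .dst Reg.e)))
         (store .p (get .dst Reg.e) Reg.t)
         skip)) ;;
  .sat ::= 1 ;;
  forBelow .e Reg.m
    (ite (.lt (get .p (get .src Reg.e) + get .wt Reg.e) (get .p (get .dst Reg.e)))
      (.sat ::= 0)
      skip)

/-- Sets `lcm` to the least common multiple of `d 0, …, d (n - 1)`, by Euclid's algorithm. -/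
def computeLcm : Stmt :=
  .lcm ::= 1 ;;
  forBelow .i Reg.n
    (.a ::= Reg.lcm ;;
     .b ::= get .d Reg.i ;;
     loop (.ne Reg.b 0)
       (.t ::= (Reg.a : Expr) % Reg.b ;;
        .a ::= Reg.b ;;
        .b ::= Reg.t) ;;
     .lcm ::= (Reg.lcm : Expr) * (get .d Reg.i / Reg.a) ;;
     ite (.lt Reg.lcm 0) (.lcm ::= 0 - (Reg.lcm : Expr)) skip)

/-- Puts each variable into a box around `p` and rounds the upper bounds. -/
def box : Stmt :=
  computeLcm ;;
  forBelow .i Reg.n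
    (store .lo Reg.i (get .p Reg.i - (Reg.n : Expr) * Reg.lcm) ;;
     store .up Reg.i (get .p Reg.i + (Reg.n : Expr) * Reg.lcm)) ;;
  forBelow .i Reg.n
    (store .up Reg.i (roundDown (get .up Reg.i) (get .d Reg.i))) ;;
  .sat ::= 1

/-- The bound that the constraint number `e` and the upper bound on its source imply for its
target, rounded down to a multiple of the stride of the target. -/
def newBound (e : Expr) : Expr :=
  roundDown (get .up (get .src e) + get .wt e) (get .d (get .dst e))

/-- Propagation of upper bounds by sweeps over all constraints, until a fixpoint or a
contradiction (`sat = 0`) is reached. -/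
def sweep : Stmt :=
  .changed ::= 1 ;;
  loop (.and (.eq Reg.changed 1) (.eq Reg.sat 1))
    (.changed ::= 0 ;;
     .e ::= 0 ;;
     loop (.and (.lt Reg.e Reg.m) (.eq Reg.sat 1))
       (.j ::= get .dst Reg.e ;;
        .t ::= newBound Reg.e ;;
        ite (.lt Reg.t (get .up Reg.j))
          (store .up Reg.j Reg.t ;;
           .changed ::= 1 ;;
           ite (.lt Reg.t (get .lo Reg.j)) (.sat ::= 0) skip)
          skip ;;
        .e ::= (Reg.e : Expr) + 1))

/-- Linked lists of the constraints leaving each variable: `head i` and `next e` hold `1 +` the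
number of a constraint, or `0` at the end of a list. -/
def buildAdjacency : Stmt :=
  forBelow .i Reg.n (store .head Reg.i 0) ;;
  forBelow .e Reg.m
    (store .next Reg.e (get .head (get .src Reg.e)) ;;
     store .head (get .src Reg.e) ((Reg.e : Expr) + 1))

/-- Propagation of upper bounds with a set of dirty variables, kept as the first `top` entries of
`pool`, with membership flags in `inDirty`. Which dirty variable is picked is arbitrary. -/
def worklist : Stmt :=
  buildAdjacency ;;
  forBelow .i Reg.n (store .pool Reg.i Reg.i ;; store .inDirty Reg.i 1) ;;
  .top ::= Reg.n ;;
  loop (.and (.lt 0 Reg.top) (.eq Reg.sat 1))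
    (pick .k Reg.top ;;
     .i ::= get .pool Reg.k ;;
     .top ::= (Reg.top : Expr) - 1 ;;
     store .pool Reg.k (get .pool Reg.top) ;;
     store .inDirty Reg.i 0 ;;
     .e ::= get .head Reg.i ;;
     loop (.and (.ne Reg.e 0) (.eq Reg.sat 1))
       (.j ::= get .dst ((Reg.e : Expr) - 1) ;;
        .t ::= newBound ((Reg.e : Expr) - 1) ;;
        ite (.lt Reg.t (get .up Reg.j))
          (store .up Reg.j Reg.t ;;
           ite (.lt Reg.t (get .lo Reg.j)) (.sat ::= 0)
             (ite (.eq (get .inDirty Reg.j) 0)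
               (store .inDirty Reg.j 1 ;;
                store .pool Reg.top Reg.j ;;
                .top ::= (Reg.top : Expr) + 1)
               skip))
          skip ;;
        .e ::= get .next ((Reg.e : Expr) - 1)))

/-- The part of the algorithm that follows the choice of `p`, with the given propagation loop. -/
def solveFrom (propagate : Stmt) : Stmt := box ;; propagate

/-- The whole algorithm with the given propagation loop, for a simple SDBM. -/
def solve (propagate : Stmt) : Stmt :=
  findIntegral ;; ite (.eq Reg.sat 1) (solveFrom propagate) skip

/-- Replaces a general SDBM by a simple one: the remainders are shifted to zero, and the variable
bounds become difference bounds against a new variable, numbered `n`, whose stride is the least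
common multiple of all divisors. -/
def makeSimple : Stmt :=
  computeLcm ;;
  forBelow .e Reg.m
    (store .wt Reg.e
      (get .wt Reg.e + (get .r (get .src Reg.e) - get .r (get .dst Reg.e)))) ;;
  forBelow .i Reg.n
    (ite (.eq (get .hasLo Reg.i) 1)
      (store .src Reg.m Reg.i ;; store .dst Reg.m Reg.n ;;
       store .wt Reg.m (get .r Reg.i - get .loBd Reg.i) ;; .m ::= (Reg.m : Expr) + 1)
      skip ;;
     ite (.eq (get .hasHi Reg.i) 1)
      (store .src Reg.m Reg.n ;; store .dst Reg.m Reg.i ;;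
       store .wt Reg.m (get .hiBd Reg.i - get .r Reg.i) ;; .m ::= (Reg.m : Expr) + 1)
      skip) ;;
  store .d Reg.n Reg.lcm ;;
  .n ::= (Reg.n : Expr) + 1

/-- The algorithm for a general SDBM: make it simple, solve, and translate the solution back. -/
def solveGeneral (propagate : Stmt) : Stmt :=
  makeSimple ;;
  solve propagate ;;
  ite (.eq Reg.sat 1)
    (.n ::= (Reg.n : Expr) - 1 ;;
     forBelow .i Reg.n
       (store .out Reg.i (get .up Reg.i - get .up Reg.n + get .r Reg.i)))
    skip

/-! ### Input and output -/

/-- The memory holds the difference bounds, listed without repetition in some order, and the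
congruence divisors of `S`. -/
def Input {n : ℕ} (S : SDBM n) (σ : Store) : Prop :=
  σ.reg .n = n ∧
  (∀ i : Fin n, σ.arr .d (i : ℕ) = S.d i) ∧
  ∃ L : List (Fin n × Fin n × ℤ), L.Nodup ∧ L.toFinset = S.E ∧ σ.reg .m = L.length ∧
    ∀ (e : ℕ) (he : e < L.length),
      σ.arr .src e = ((L[e].1 : ℕ) : ℤ) ∧ σ.arr .dst e = ((L[e].2.1 : ℕ) : ℤ) ∧
      σ.arr .wt e = L[e].2.2

/-- The memory holds the remainders and the variable bounds of `S`. -/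
def InputBounds {n : ℕ} (S : SDBM n) (σ : Store) : Prop :=
  (∀ i : Fin n, σ.arr .r (i : ℕ) = S.r i) ∧
  (∀ i : Fin n, σ.arr .hasLo (i : ℕ) = if (S.lower i).isSome then 1 else 0) ∧
  (∀ i : Fin n, ∀ l ∈ S.lower i, σ.arr .loBd (i : ℕ) = l) ∧
  (∀ i : Fin n, σ.arr .hasHi (i : ℕ) = if (S.upper i).isSome then 1 else 0) ∧
  (∀ i : Fin n, ∀ u ∈ S.upper i, σ.arr .hiBd (i : ℕ) = u)

/-- The first `n` entries of an array. -/
def vec (n : ℕ) (σ : Store) (A : Arr) : Fin n → ℤ := fun i => σ.arr A (i : ℕ)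

/-- The final memory `σ` is a correct answer for `S`: either `sat = 1` and the array `A` holds a
solution of `S`, or `sat = 0` and `S` is unsatisfiable. -/
def CorrectAnswer {n : ℕ} (S : SDBM n) (A : Arr) (σ : Store) : Prop :=
  (σ.reg .sat = 1 ∧ S.IsSolution (vec n σ A)) ∨ (σ.reg .sat = 0 ∧ ¬ S.Satisfiable)

end SolveSDBM

/-!
Soundness and completeness rest on one fact about a system with zero remainders. Let `p` be an
integral solution of the difference bounds, `D` the least common multiple of the strides, and suppose
that the system is satisfiable. Shifting a solution by a multiple of `D` gives another one, so there
are solutions below `p + n D`; take a maximal one, `x`. If some `x v - p v` were negative, then one of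
the `n` blocks `[k D, (k + 1) D)`, `0 ≤ k < n`, would contain none of the differences `x i - p i`, and
raising by `D` all coordinates whose difference lies below that block would violate no difference
bound. This contradicts maximality, so `p ≤ x ≤ p + n D` (`Table.Valid.exists_solution_near`).
Propagation keeps the upper bounds above every solution below `p + n D`
(`Table.UpperBounds.update`). Hence a bound that falls below `p - n D` refutes the system, and a
fixpoint of the propagation is itself a solution.

The same maximality argument shows that Bellman-Ford relaxation from the zero vector is complete: if
the difference bounds have a solution, each round makes a further coordinate agree with a maximal
nonpositive solution (`Table.IsTop.exists_settled`), so `n` rounds reach it.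

The running time is controlled by the potential `slack`: each bound can be lowered at most
`2 n D + 1` times before it leaves the box. Every sweep but the last lowers a bound, which gives at
most `n (2 n D + 1) + 1` sweeps of `O(m)` steps. In the worklist version, each scan of a variable with
`k` outgoing constraints is paid by the initial pool or by a decrease of the bound of that variable
that counts `k`-fold, and since the numbers of outgoing constraints add up to `m`, the total is
`O(n m D)` (`Table.credit`, `scan_ends`).

A general system is reduced to one with zero remainders by the substitution `y i = x i - r i` and a new
variable of stride `D` that stands for zero (`BoundedTable.Reduces`).

Programs are treated by a weakest precondition calculus in which the number of steps is visible
(`RAM.Ends`), with a loop rule that carries a potential (`RAM.Ends.loop`).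
-/

/-! ### Reasoning about programs and their running time -/

namespace RAM

@[simp] theorem Store.setReg_reg (σ : Store) (x y : Reg) (v : ℤ) :
    (σ.setReg x v).reg y = if y = x then v else σ.reg y := by
  simp [Store.setReg, Function.update_apply]

@[simp] theorem Store.setReg_arr (σ : Store) (x : Reg) (v : ℤ) :
    (σ.setReg x v).arr = σ.arr := rfl

@[simp] theorem Store.setArr_reg (σ : Store) (A : Arr) (k v : ℤ) :
    (σ.setArr A k v).reg = σ.reg := rfl

@[simp] theorem Store.setArr_arr (σ : Store) (A B : Arr) (k v : ℤ) :
    (σ.setArr A k v).arr B = if B = A then Function.update (σ.arr A) k v else σ.arr B := by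
  by_cases h : B = A
  · subst h; simp [Store.setArr]
  · simp [Store.setArr, h]

namespace Expr

@[simp] theorem eval_reg (σ : Store) (x : Reg) : (reg x).eval σ = σ.reg x := rfl
@[simp] theorem eval_get (σ : Store) (A : Arr) (e : Expr) :
    (get A e).eval σ = σ.arr A (e.eval σ) := rfl
@[simp] theorem eval_zero (σ : Store) : (0 : Expr).eval σ = 0 := rfl
@[simp] theorem eval_one (σ : Store) : (1 : Expr).eval σ = 1 := rfl
@[simp] theorem eval_hAdd (σ : Store) (e f : Expr) : (e + f).eval σ = e.eval σ + f.eval σ := rfl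
@[simp] theorem eval_hSub (σ : Store) (e f : Expr) : (e - f).eval σ = e.eval σ - f.eval σ := rfl
@[simp] theorem eval_hMul (σ : Store) (e f : Expr) : (e * f).eval σ = e.eval σ * f.eval σ := rfl
@[simp] theorem eval_hDiv (σ : Store) (e f : Expr) : (e / f).eval σ = e.eval σ / f.eval σ := rfl
@[simp] theorem eval_hMod (σ : Store) (e f : Expr) : (e % f).eval σ = e.eval σ % f.eval σ := rfl

@[simp] theorem cost_reg (x : Reg) : (reg x).cost = 1 := rfl
@[simp] theorem cost_get (A : Arr) (e : Expr) : (get A e).cost = e.cost + 1 := rfl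
@[simp] theorem cost_zero : (0 : Expr).cost = 1 := rfl
@[simp] theorem cost_one : (1 : Expr).cost = 1 := rfl
@[simp] theorem cost_hAdd (e f : Expr) : (e + f).cost = e.cost + f.cost + 1 := rfl
@[simp] theorem cost_hSub (e f : Expr) : (e - f).cost = e.cost + f.cost + 1 := rfl
@[simp] theorem cost_hMul (e f : Expr) : (e * f).cost = e.cost + f.cost + 1 := rfl
@[simp] theorem cost_hDiv (e f : Expr) : (e / f).cost = e.cost + f.cost + 1 := rfl
@[simp] theorem cost_hMod (e f : Expr) : (e % f).cost = e.cost + f.cost + 1 := rfl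

end Expr

/-- Whether the register `x` is assigned somewhere in the program. -/
def Stmt.writesReg : Stmt → Reg → Bool
  | .skip, _ => false
  | .set y _, x => decide (x = y)
  | .store _ _ _, _ => false
  | .pick y _, x => decide (x = y)
  | .seq s s', x => s.writesReg x || s'.writesReg x
  | .ite _ s s', x => s.writesReg x || s'.writesReg x
  | .loop _ s, x => s.writesReg x

/-- Whether an entry of the array `A` is assigned somewhere in the program. -/
def Stmt.writesArr : Stmt → Arr → Bool
  | .skip, _ => false
  | .set _ _, _ => false
  | .store B _ _, A => decide (A = B)
  | .pick _ _, _ => false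
  | .seq s s', A => s.writesArr A || s'.writesArr A
  | .ite _ s s', A => s.writesArr A || s'.writesArr A
  | .loop _ s, A => s.writesArr A

/-- The memories `σ` and `τ` agree on everything that `s` does not assign. -/
structure Frame (s : Stmt) (σ τ : Store) : Prop where
  reg : ∀ x, s.writesReg x = false → τ.reg x = σ.reg x
  arr : ∀ A, s.writesArr A = false → τ.arr A = σ.arr A

theorem Frame.refl (s : Stmt) (σ : Store) : Frame s σ σ := ⟨fun _ _ => rfl, fun _ _ => rfl⟩

theorem Frame.trans {s : Stmt} {σ τ υ : Store} (h : Frame s σ τ) (h' : Frame s τ υ) :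
    Frame s σ υ :=
  ⟨fun x hx => (h'.reg x hx).trans (h.reg x hx), fun A hA => (h'.arr A hA).trans (h.arr A hA)⟩

theorem Frame.mono {s s' : Stmt} {σ τ : Store} (h : Frame s σ τ)
    (hr : ∀ x, s'.writesReg x = false → s.writesReg x = false)
    (ha : ∀ A, s'.writesArr A = false → s.writesArr A = false) : Frame s' σ τ :=
  ⟨fun x hx => h.reg x (hr x hx), fun A hA => h.arr A (ha A hA)⟩

theorem Exec.frame {s : Stmt} {σ τ : Store} {t : ℕ} (h : Exec s σ t τ) : Frame s σ τ := by
  induction h with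
  | skip => exact Frame.refl _ _
  | set x e σ => exact ⟨fun y hy => by simp_all [Stmt.writesReg], fun _ _ => rfl⟩
  | store A idx e σ => exact ⟨fun _ _ => rfl, fun B hB => by simp_all [Stmt.writesArr]⟩
  | pick x e σ => exact ⟨fun y hy => by simp_all [Stmt.writesReg], fun _ _ => rfl⟩
  | seq _ _ ih₁ ih₂ =>
    exact (ih₁.mono (by simp +contextual [Stmt.writesReg])
      (by simp +contextual [Stmt.writesArr])).trans (ih₂.mono
      (by simp +contextual [Stmt.writesReg]) (by simp +contextual [Stmt.writesArr]))
  | iteTrue _ _ ih =>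
    exact ih.mono (by simp +contextual [Stmt.writesReg]) (by simp +contextual [Stmt.writesArr])
  | iteFalse _ _ ih =>
    exact ih.mono (by simp +contextual [Stmt.writesReg]) (by simp +contextual [Stmt.writesArr])
  | loopTrue _ _ _ ih₁ ih₂ => exact Frame.trans ⟨ih₁.reg, ih₁.arr⟩ ih₂
  | loopFalse => exact Frame.refl _ _

/-- The run of `s` from `σ` halts, and its number of steps and its final memory satisfy `Q`.
This is a weakest precondition for total correctness, with the running time made visible. -/
def Ends (s : Stmt) (σ : Store) (Q : ℕ → Store → Prop) : Prop :=
  ∃ (t : ℕ) (τ : Store), Exec s σ t τ ∧ Q t τ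

namespace Ends

variable {s s' : Stmt} {c : Cond} {σ : Store} {Q R : ℕ → Store → Prop}

theorem mono (h : Ends s σ Q) (hQ : ∀ t τ, Frame s σ τ → Q t τ → R t τ) : Ends s σ R := by
  obtain ⟨t, τ, hE, hq⟩ := h
  exact ⟨t, τ, hE, hQ t τ hE.frame hq⟩

theorem seq (h : Ends s σ Q)
    (h' : ∀ t τ, Frame s σ τ → Q t τ → Ends s' τ fun t' υ => R (t + t') υ) :
    Ends (.seq s s') σ R := by
  obtain ⟨t, τ, hE, hq⟩ := h
  obtain ⟨t', υ, hE', hr⟩ := h' t τ hE.frame hq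
  exact ⟨t + t', υ, hE.seq hE', hr⟩

theorem ite (hT : c.Holds σ → Ends s σ fun t τ => R (c.cost + 1 + t) τ)
    (hF : ¬ c.Holds σ → Ends s' σ fun t τ => R (c.cost + 1 + t) τ) :
    Ends (.ite c s s') σ R := by
  by_cases hc : c.Holds σ
  · obtain ⟨t, τ, hE, hr⟩ := hT hc
    exact ⟨_, τ, .iteTrue hc hE, hr⟩
  · obtain ⟨t, τ, hE, hr⟩ := hF hc
    exact ⟨_, τ, .iteFalse hc hE, hr⟩

@[simp] theorem skip_iff : Ends .skip σ Q ↔ Q 1 σ :=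
  ⟨fun ⟨_, _, h, hq⟩ => by cases h; exact hq, fun h => ⟨_, _, .skip σ, h⟩⟩

@[simp] theorem set_iff {x : Reg} {e : Expr} :
    Ends (.set x e) σ Q ↔ Q (e.cost + 1) (σ.setReg x (e.eval σ)) :=
  ⟨fun ⟨_, _, h, hq⟩ => by cases h; exact hq, fun h => ⟨_, _, .set x e σ, h⟩⟩

@[simp] theorem store_iff {A : Arr} {idx e : Expr} :
    Ends (.store A idx e) σ Q ↔
      Q (idx.cost + e.cost + 1) (σ.setArr A (idx.eval σ) (e.eval σ)) :=
  ⟨fun ⟨_, _, h, hq⟩ => by cases h; exact hq, fun h => ⟨_, _, .store A idx e σ, h⟩⟩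

@[simp] theorem pick_iff {x : Reg} {e : Expr} :
    Ends (.pick x e) σ Q ↔ Q (e.cost + 1)
      { σ.setReg x ((σ.choices 0 : ℤ) % e.eval σ) with choices := fun k => σ.choices (k + 1) } :=
  ⟨fun ⟨_, _, h, hq⟩ => by cases h; exact hq, fun h => ⟨_, _, .pick x e σ, h⟩⟩

@[simp] theorem seq_iff :
    Ends (.seq s s') σ Q ↔ Ends s σ fun t τ => Ends s' τ fun t' υ => Q (t + t') υ := by
  constructor
  · rintro ⟨_, _, h, hq⟩
    cases h with
    | seq h₁ h₂ => exact ⟨_, _, h₁, _, _, h₂, hq⟩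
  · rintro ⟨_, _, h₁, _, _, h₂, hq⟩
    exact ⟨_, _, h₁.seq h₂, hq⟩

@[simp] theorem ite_iff :
    Ends (.ite c s s') σ Q ↔
      (c.Holds σ → Ends s σ fun t τ => Q (c.cost + 1 + t) τ) ∧
      (¬ c.Holds σ → Ends s' σ fun t τ => Q (c.cost + 1 + t) τ) := by
  constructor
  · rintro ⟨_, _, h, hq⟩
    cases h with
    | iteTrue hc h => exact ⟨fun _ => ⟨_, _, h, hq⟩, fun hn => absurd hc hn⟩
    | iteFalse hc h => exact ⟨fun hy => absurd hy hc, fun _ => ⟨_, _, h, hq⟩⟩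
  · exact fun h => Ends.ite h.1 h.2

/-- Amortized analysis of a loop: the potential `V` pays for every pass and bounds the number of steps
still to be spent. Since every pass takes a step, the loop halts. -/
theorem loop {σ₀ : Store} (I : Store → Prop) (V : Store → ℕ) (h₀ : I σ₀)
    (step : ∀ σ, Frame s σ₀ σ → c.Holds σ → I σ →
      Ends s σ fun t τ => I τ ∧ c.cost + 1 + t + V τ ≤ V σ) :
    Ends (.loop c s) σ₀ fun t τ => I τ ∧ ¬ c.Holds τ ∧ t + V τ ≤ V σ₀ + c.cost + 1 := by
  suffices H : ∀ w σ, V σ = w → Frame s σ₀ σ → I σ → Ends (.loop c s) σ fun t τ =>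
      I τ ∧ ¬ c.Holds τ ∧ t + V τ ≤ w + c.cost + 1 from H _ σ₀ rfl (Frame.refl _ _) h₀
  intro w
  induction w using Nat.strong_induction_on with
  | _ w ih =>
    rintro σ rfl hF hI
    by_cases hc : c.Holds σ
    · obtain ⟨t, τ, hE, hI', hw⟩ := step σ hF hc hI
      obtain ⟨t', υ, hE', hI'', hn, hw'⟩ := ih (V τ) (by omega) τ rfl (hF.trans hE.frame) hI'
      exact ⟨_, υ, .loopTrue hc hE hE', hI'', hn, by omega⟩
    · exact ⟨_, σ, .loopFalse hc, hI, hc, by omega⟩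

/-- A counting loop whose passes take at most `K` steps each. The invariant `I k` holds before pass
number `k`. -/
theorem forBelow {σ₀ : Store} {x y : Reg} {N : ℕ} (K : ℕ) (I : ℤ → Store → Prop)
    (hN : σ₀.reg y = N) (hxy : y ≠ x)
    (hx : s.writesReg x = false) (hy : s.writesReg y = false)
    (h₀ : I 0 (σ₀.setReg x 0))
    (step : ∀ (k : ℤ) σ, 0 ≤ k → k < N → Frame (.seq s (.set x 0)) σ₀ σ → σ.reg x = k →
      I k σ → Ends s σ fun t τ => t ≤ K ∧ I (k + 1) (τ.setReg x (k + 1))) :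
    Ends (.forBelow x y s) σ₀ fun t τ => t ≤ N * (K + 8) + 6 ∧ I N τ := by
  have hL := Ends.loop (c := .lt x y) (s := .seq s (.set x ((x : Expr) + 1)))
    (σ₀ := σ₀.setReg x 0)
    (I := fun σ => 0 ≤ σ.reg x ∧ σ.reg x ≤ N ∧ I (σ.reg x) σ)
    (V := fun σ => (N - σ.reg x).toNat * (K + 8))
    ⟨by simp, by simp, by simpa using h₀⟩ ?_
  · refine (set_iff.2 ?_ : Ends (.set x 0) σ₀ fun t τ => t = 2 ∧ τ = σ₀.setReg x 0).seq ?_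
    · simp
    rintro _ _ - ⟨rfl, rfl⟩
    refine hL.mono ?_
    rintro t τ hF ⟨⟨hk₀, hk, hI⟩, hc, hw⟩
    have hyv : τ.reg y = N := by
      rw [hF.reg y (by simp [Stmt.writesReg, hy, hxy])]; simp [hxy, hN]
    simp only [Cond.Holds, Expr.eval_reg, hyv] at hc
    have hkx : τ.reg x = N := by omega
    simp [Cond.cost] at hw
    rw [hkx] at hI
    exact ⟨by omega, hI⟩
  · rintro σ hF hc ⟨hk₀, hk, hI⟩
    have hyv : σ.reg y = N := by
      rw [hF.reg y (by simp [Stmt.writesReg, hy, hxy])]; simp [hxy, hN]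
    simp only [Cond.Holds, Expr.eval_reg, hyv] at hc
    have hF' : Frame (.seq s (.set x 0)) σ₀ σ := by
      refine Frame.trans (τ := σ₀.setReg x 0) ⟨fun z hz => ?_, fun _ _ => rfl⟩ ⟨hF.reg, hF.arr⟩
      simp only [Stmt.writesReg, Bool.or_eq_false_iff, decide_eq_false_iff_not] at hz
      simp [hz.2]
    refine (step _ σ hk₀ hc hF' rfl hI).seq ?_
    rintro t τ hFτ ⟨ht, hI'⟩
    have hτx : τ.reg x = σ.reg x := hFτ.reg x hx
    simp only [set_iff, Expr.eval_hAdd, Expr.eval_reg, Expr.eval_one, hτx, Cond.cost,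
      Expr.cost_reg, Expr.cost_hAdd, Expr.cost_one, Store.setReg_reg, if_true]
    refine ⟨⟨by omega, by omega, hI'⟩, ?_⟩
    have : (N - σ.reg x).toNat = (N - (σ.reg x + 1)).toNat + 1 := by omega
    rw [this, Nat.add_mul]
    omega

end Ends

end RAM

/-! ### Simple systems as tables of integers -/

namespace SolveSDBM

open RAM

/-- A simple SDBM as it is laid out in memory: `n` variables and `m` constraints, numbered from
`0`; constraint `e` says `x (dst e) ≤ x (src e) + wt e`, and `d i` is the stride of variable `i`. Only
the values at indices in range matter. -/
structure Table where
  n : ℕ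
  m : ℕ
  src : ℤ → ℤ
  dst : ℤ → ℤ
  wt : ℤ → ℤ
  d : ℤ → ℤ

namespace Table

/-- The constraints only mention existing variables, and the strides are nonzero. -/
structure Valid (T : Table) : Prop where
  src_nonneg : ∀ e : ℤ, 0 ≤ e → e < T.m → 0 ≤ T.src e
  src_lt : ∀ e : ℤ, 0 ≤ e → e < T.m → T.src e < T.n
  dst_nonneg : ∀ e : ℤ, 0 ≤ e → e < T.m → 0 ≤ T.dst e
  dst_lt : ∀ e : ℤ, 0 ≤ e → e < T.m → T.dst e < T.n
  d_ne_zero : ∀ i : ℤ, 0 ≤ i → i < T.n → T.d i ≠ 0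

/-- `x` satisfies the difference bounds. -/
def Feasible (T : Table) (x : ℤ → ℤ) : Prop :=
  ∀ e : ℤ, 0 ≤ e → e < T.m → x (T.dst e) ≤ x (T.src e) + T.wt e

/-- `x` satisfies the difference bounds and the congruences. -/
def Solves (T : Table) (x : ℤ → ℤ) : Prop :=
  T.Feasible x ∧ ∀ i : ℤ, 0 ≤ i → i < T.n → T.d i ∣ x i

/-- The least common multiple of the strides of the variables below `k`. -/
noncomputable def lcmBelow (T : Table) (k : ℤ) : ℕ := (Finset.Ico 0 k).lcm fun i => (T.d i).natAbs

/-- The least common multiple of all strides. -/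
noncomputable def lcmDiv (T : Table) : ℕ := T.lcmBelow T.n

theorem lcmBelow_zero (T : Table) : T.lcmBelow 0 = 1 := by simp [lcmBelow]

theorem lcmBelow_succ (T : Table) {k : ℤ} (hk : 0 ≤ k) :
    T.lcmBelow (k + 1) = Nat.lcm (T.lcmBelow k) (T.d k).natAbs := by
  have : Finset.Ico 0 (k + 1) = insert k (Finset.Ico 0 k) := by
    ext; simp only [Finset.mem_insert, Finset.mem_Ico]; omega
  rw [lcmBelow, this, Finset.lcm_insert, lcmBelow, lcm_eq_nat_lcm, Nat.lcm_comm]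

theorem dvd_lcmDiv (T : Table) {i : ℤ} (h₀ : 0 ≤ i) (h : i < T.n) : T.d i ∣ (T.lcmDiv : ℤ) := by
  rw [← Int.natAbs_dvd_natAbs, Int.natAbs_natCast]
  exact Finset.dvd_lcm (f := fun i => (T.d i).natAbs) (Finset.mem_Ico.2 ⟨h₀, h⟩)

theorem Valid.lcmBelow_pos {T : Table} (hT : T.Valid) {k : ℤ} (hk : k ≤ T.n) :
    0 < T.lcmBelow k := by
  rw [Nat.pos_iff_ne_zero, lcmBelow, Ne, Finset.lcm_eq_zero_iff]
  simp only [Finset.mem_Ico, Int.natAbs_eq_zero]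
  rintro ⟨i, hi, h⟩
  exact hT.d_ne_zero i hi.1 (by omega) h

theorem Valid.lcmDiv_pos {T : Table} (hT : T.Valid) : 0 < T.lcmDiv := hT.lcmBelow_pos le_rfl

theorem Valid.natAbs_d_le {T : Table} (hT : T.Valid) {i : ℤ} (h₀ : 0 ≤ i) (h : i < T.n) :
    (T.d i).natAbs ≤ T.lcmDiv :=
  Nat.le_of_dvd hT.lcmDiv_pos
    (Finset.dvd_lcm (f := fun i => (T.d i).natAbs) (Finset.mem_Ico.2 ⟨h₀, h⟩))

/-- A nonempty set of vectors that is bounded above has a maximal element. -/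
theorem exists_maximal_vector (n : ℕ) {P : (ℤ → ℤ) → Prop} (b : ℤ → ℤ)
    (hb : ∀ x, P x → ∀ i : ℤ, 0 ≤ i → i < n → x i ≤ b i) (hP : ∃ x, P x) :
    ∃ x, P x ∧ ∀ y, P y → (∀ i : ℤ, 0 ≤ i → i < n → x i ≤ y i) →
      ∀ i : ℤ, 0 ≤ i → i < n → y i = x i := by
  obtain ⟨x₀, hx₀⟩ := hP
  -- a vector of greatest coordinate sum is maximal
  obtain ⟨s, ⟨x, hx, rfl⟩, hs⟩ := Int.exists_greatest_of_bdd
    (P := fun s => ∃ x, P x ∧ ∑ i ∈ Finset.Ico (0 : ℤ) n, x i = s)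
    ⟨∑ i ∈ Finset.Ico (0 : ℤ) n, b i, by
      rintro _ ⟨x, hx, rfl⟩
      exact Finset.sum_le_sum fun i hi =>
        hb x hx i (Finset.mem_Ico.1 hi).1 (Finset.mem_Ico.1 hi).2⟩ ⟨_, x₀, hx₀, rfl⟩
  refine ⟨x, hx, fun y hy hxy i h₀ hi => ?_⟩
  have hle : ∀ i ∈ Finset.Ico (0 : ℤ) n, x i ≤ y i := fun i hi =>
    hxy i (Finset.mem_Ico.1 hi).1 (Finset.mem_Ico.1 hi).2
  exact ((Finset.sum_eq_sum_iff_of_le hle).1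
    (le_antisymm (Finset.sum_le_sum hle) (hs _ ⟨y, hy, rfl⟩)) i (Finset.mem_Ico.2 ⟨h₀, hi⟩)).symm

theorem exists_bound (n : ℕ) (f : ℤ → ℤ) :
    ∃ M : ℤ, 0 ≤ M ∧ ∀ i : ℤ, 0 ≤ i → i < n → f i ≤ M := by
  refine ⟨∑ i ∈ Finset.Ico (0 : ℤ) n, |f i|, Finset.sum_nonneg fun _ _ => abs_nonneg _,
    fun i h₀ hi => (le_abs_self _).trans ?_⟩
  exact Finset.single_le_sum (f := fun i => |f i|) (fun _ _ => abs_nonneg _)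
    (Finset.mem_Ico.2 ⟨h₀, hi⟩)

theorem Feasible.sub_const {T : Table} {x : ℤ → ℤ} (hx : T.Feasible x) (M : ℤ) :
    T.Feasible fun i => x i - M := by
  intro e h₀ he
  have := hx e h₀ he
  simp only
  omega

/-- `δ` is a maximal integral solution of the difference bounds among those without positive
coordinates. -/
structure IsTop (T : Table) (δ : ℤ → ℤ) : Prop where
  feasible : T.Feasible δ
  nonpos : ∀ i : ℤ, 0 ≤ i → i < T.n → δ i ≤ 0
  maximal : ∀ y, T.Feasible y → (∀ i : ℤ, 0 ≤ i → i < T.n → y i ≤ 0) →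
    (∀ i : ℤ, 0 ≤ i → i < T.n → δ i ≤ y i) → ∀ i : ℤ, 0 ≤ i → i < T.n → y i = δ i

theorem exists_isTop {T : Table} {x : ℤ → ℤ} (hx : T.Feasible x) : ∃ δ, T.IsTop δ := by
  obtain ⟨M, -, hM⟩ := exists_bound T.n x
  obtain ⟨δ, ⟨h₁, h₂⟩, h₃⟩ := exists_maximal_vector T.n
    (P := fun y => T.Feasible y ∧ ∀ i : ℤ, 0 ≤ i → i < T.n → y i ≤ 0) (fun _ => 0)
    (fun y hy => hy.2) ⟨fun i => x i - M, hx.sub_const M, fun i h₀ hi => by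
      have := hM i h₀ hi
      simp only
      omega⟩
  exact ⟨δ, h₁, h₂, fun y hy hy' => h₃ y ⟨hy, hy'⟩⟩

/-- Progress of Bellman-Ford relaxation: a round from `p` to `p'` settles a further coordinate,
unless all are settled. Otherwise, raising the unsettled coordinates of `δ` by one would keep all
difference bounds valid. -/
theorem IsTop.exists_settled {T : Table} (hT : T.Valid) {δ p p' : ℤ → ℤ} (hδ : T.IsTop δ)
    (hp0 : ∀ i : ℤ, 0 ≤ i → i < T.n → p i ≤ 0) (hδp : ∀ i : ℤ, 0 ≤ i → i < T.n → δ i ≤ p i)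
    (hδp' : ∀ i : ℤ, 0 ≤ i → i < T.n → δ i ≤ p' i)
    (hround : ∀ e : ℤ, 0 ≤ e → e < T.m → p' (T.dst e) ≤ p (T.src e) + T.wt e)
    (hne : ∃ i : ℤ, 0 ≤ i ∧ i < T.n ∧ p i ≠ δ i) :
    ∃ i : ℤ, 0 ≤ i ∧ i < T.n ∧ p i ≠ δ i ∧ p' i = δ i := by
  by_contra! hcon
  obtain ⟨v, hv₀, hv, hvne⟩ := hne
  have h := hδ.maximal (fun i => if p i = δ i then δ i else δ i + 1) ?_ ?_ ?_ v hv₀ hv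
  · simp [hvne] at h
  · intro e h₀ he
    have hd₀ := hT.dst_nonneg e h₀ he
    have hd := hT.dst_lt e h₀ he
    have h₁ := hδ.feasible e h₀ he
    have h₂ := hround e h₀ he
    have h₃ := hcon _ hd₀ hd
    have h₄ := hδp' _ hd₀ hd
    simp only
    split_ifs <;> grind
  · intro i h₀ hi
    have := hp0 i h₀ hi
    have := hδp i h₀ hi
    split_ifs <;> omega
  · intro i _ _
    split_ifs <;> omega

/-- Among the solutions below `p + n D`, a maximal one lies above `p`. If it fell below `p` at some
variable, then one of the `n` blocks `[k D, (k + 1) D)` would contain no difference `x i - p i`;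
raising by `D` all coordinates with a difference below that block gives a larger solution. -/
theorem Valid.exists_solution_near {T : Table} (hT : T.Valid) {p x₀ : ℤ → ℤ}
    (hp : T.Feasible p) (hx₀ : T.Solves x₀) :
    ∃ x, T.Solves x ∧ ∀ i : ℤ, 0 ≤ i → i < T.n → p i ≤ x i ∧ x i ≤ p i + T.n * T.lcmDiv := by
  have hD : (1 : ℤ) ≤ T.lcmDiv := by exact_mod_cast hT.lcmDiv_pos
  have hdvd : ∀ i : ℤ, 0 ≤ i → i < T.n → T.d i ∣ (T.lcmDiv : ℤ) := fun i h₀ hi => T.dvd_lcmDiv h₀ hi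
  generalize (T.lcmDiv : ℤ) = D at hD hdvd ⊢
  obtain ⟨M, hM₀, hM⟩ := exists_bound T.n fun i => x₀ i - p i
  obtain ⟨x, ⟨hx, hxle⟩, hmax⟩ := exists_maximal_vector T.n
    (P := fun y => T.Solves y ∧ ∀ i : ℤ, 0 ≤ i → i < T.n → y i ≤ p i + T.n * D)
    (fun i => p i + T.n * D) (fun y hy => hy.2)
    ⟨fun i => x₀ i - M * D, ⟨hx₀.1.sub_const _, fun i h₀ hi =>
      dvd_sub (hx₀.2 i h₀ hi) ((hdvd i h₀ hi).mul_left _)⟩, fun i h₀ hi => by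
      have := hM i h₀ hi
      simp only at this ⊢
      have : 0 ≤ (T.n : ℤ) * D := by positivity
      nlinarith⟩
  refine ⟨x, hx, fun v hv₀ hv => ⟨?_, hxle v hv₀ hv⟩⟩
  by_contra! hlt
  -- the block that contains no difference
  obtain ⟨k, hk₀, hk, hkD⟩ : ∃ k : ℤ, 0 ≤ k ∧ k < T.n ∧
      ∀ i : ℤ, 0 ≤ i → i < T.n → (x i - p i) / D ≠ k := by
    by_contra! hcon
    have hsub : Finset.Ico (0 : ℤ) T.n ⊆
        ((Finset.Ico (0 : ℤ) T.n).erase v).image fun i => (x i - p i) / D := by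
      intro k hk
      rw [Finset.mem_Ico] at hk
      obtain ⟨i, h₀, hi, hik⟩ := hcon k hk.1 hk.2
      refine Finset.mem_image.2 ⟨i, Finset.mem_erase.2 ⟨?_, Finset.mem_Ico.2 ⟨h₀, hi⟩⟩, hik⟩
      rintro rfl
      have : (x i - p i) / D < 0 := Int.ediv_neg_of_neg_of_pos (by omega) (by omega)
      omega
    have hvm : v ∈ Finset.Ico (0 : ℤ) T.n := Finset.mem_Ico.2 ⟨hv₀, hv⟩
    have h₁ := (Finset.card_le_card hsub).trans Finset.card_image_le
    rw [Finset.card_erase_of_mem hvm] at h₁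
    have h₂ : 0 < (Finset.Ico (0 : ℤ) T.n).card := Finset.card_pos.2 ⟨v, hvm⟩
    omega
  have hdich : ∀ i : ℤ, 0 ≤ i → i < T.n → x i - p i < k * D ∨ (k + 1) * D ≤ x i - p i := by
    intro i h₀ hi
    rcases lt_or_gt_of_ne (hkD i h₀ hi) with h | h
    · exact Or.inl ((Int.ediv_lt_iff_lt_mul (by omega)).1 h)
    · exact Or.inr ((Int.le_ediv_iff_mul_le (by omega)).1 h)
  have hkn : (k + 1) * D ≤ T.n * D := mul_le_mul_of_nonneg_right (by omega) (by omega)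
  have hkD₀ : 0 ≤ k * D := by positivity
  have hexp : (k + 1) * D = k * D + D := by ring
  have h := hmax (fun i => if x i - p i < k * D then x i + D else x i) ⟨⟨?_, ?_⟩, ?_⟩ ?_ v hv₀ hv
  · rw [if_pos (by omega)] at h
    omega
  · intro e h₀ he
    have h₁ := hx.1 e h₀ he
    have h₂ := hp e h₀ he
    have h₃ := hdich _ (hT.src_nonneg e h₀ he) (hT.src_lt e h₀ he)
    simp only
    split_ifs <;> omega
  · intro i h₀ hi
    simp only
    split_ifs
    · exact dvd_add (hx.2 i h₀ hi) (hdvd i h₀ hi)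
    · exact hx.2 i h₀ hi
  · intro i h₀ hi
    have := hxle i h₀ hi
    split_ifs <;> omega
  · intro i _ _
    split_ifs <;> omega

/-! ### The propagation of upper bounds -/

/-- The bound that constraint `e` and the upper bounds `u` imply for the target of `e`. -/
def newBound (T : Table) (u : ℤ → ℤ) (e : ℤ) : ℤ :=
  T.d (T.dst e) * ((u (T.src e) + T.wt e) / T.d (T.dst e))

theorem le_roundDown {x y d : ℤ} (hd : d ≠ 0) (hdx : d ∣ x) (h : x ≤ y) : x ≤ d * (y / d) := by
  obtain ⟨k, rfl⟩ := hdx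
  have h₁ := Int.mul_ediv_add_emod y d
  have h₂ := Int.emod_lt_abs y hd
  by_contra! h₃
  have h₄ : |d| ≤ d * k - d * (y / d) := by
    refine Int.le_of_dvd (by omega) ((abs_dvd _ _).2 ?_)
    exact dvd_sub (dvd_mul_right _ _) (dvd_mul_right _ _)
  omega

theorem newBound_le {T : Table} (hT : T.Valid) (u : ℤ → ℤ) {e : ℤ} (h₀ : 0 ≤ e) (he : e < T.m) :
    T.newBound u e ≤ u (T.src e) + T.wt e :=
  Int.mul_ediv_self_le (hT.d_ne_zero _ (hT.dst_nonneg e h₀ he) (hT.dst_lt e h₀ he))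

/-- Constraint `e` does not improve the upper bounds `u`. -/
def Tight (T : Table) (u : ℤ → ℤ) (e : ℤ) : Prop := u (T.dst e) ≤ T.newBound u e

/-- What holds for the upper bounds `u` at any time during the propagation, started from the box of
radius `n D` around `p`. -/
structure UpperBounds (T : Table) (p u : ℤ → ℤ) : Prop where
  dvd : ∀ i : ℤ, 0 ≤ i → i < T.n → T.d i ∣ u i
  le : ∀ i : ℤ, 0 ≤ i → i < T.n → u i ≤ p i + T.n * T.lcmDiv
  above : ∀ x, T.Solves x → (∀ i : ℤ, 0 ≤ i → i < T.n → x i ≤ p i + T.n * T.lcmDiv) →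
    ∀ i : ℤ, 0 ≤ i → i < T.n → x i ≤ u i

theorem UpperBounds.update {T : Table} (hT : T.Valid) {p u : ℤ → ℤ} (hu : T.UpperBounds p u)
    {e : ℤ} (h₀ : 0 ≤ e) (he : e < T.m) (hlt : T.newBound u e < u (T.dst e)) :
    T.UpperBounds p (Function.update u (T.dst e) (T.newBound u e)) where
  dvd i hi₀ hi := by
    rcases eq_or_ne i (T.dst e) with rfl | h
    · simp [newBound]
    · simpa [h] using hu.dvd i hi₀ hi
  le i hi₀ hi := by
    have := hu.le i hi₀ hi
    rcases eq_or_ne i (T.dst e) with rfl | h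
    · simp only [Function.update_self]; omega
    · simpa [h] using this
  above x hx hxp i hi₀ hi := by
    rcases eq_or_ne i (T.dst e) with rfl | h
    · rw [Function.update_self]
      refine le_roundDown (hT.d_ne_zero _ hi₀ hi) (hx.2 _ hi₀ hi) ((hx.1 e h₀ he).trans ?_)
      have := hu.above x hx hxp _ (hT.src_nonneg e h₀ he) (hT.src_lt e h₀ he)
      omega
    · simpa [h] using hu.above x hx hxp i hi₀ hi

theorem UpperBounds.solves {T : Table} (hT : T.Valid) {p u : ℤ → ℤ} (hu : T.UpperBounds p u)
    (h : ∀ e : ℤ, 0 ≤ e → e < T.m → T.Tight u e) : T.Solves u :=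
  ⟨fun e h₀ he => (h e h₀ he).trans (newBound_le hT u h₀ he), hu.dvd⟩

/-- An upper bound below the box refutes the system: a satisfiable system has a solution in the
box. -/
theorem UpperBounds.not_solves {T : Table} (hT : T.Valid) {p u : ℤ → ℤ} (hp : T.Feasible p)
    (hu : T.UpperBounds p u) {i : ℤ} (h₀ : 0 ≤ i) (hi : i < T.n)
    (hlt : u i < p i - T.n * T.lcmDiv) : ¬ ∃ x, T.Solves x := by
  rintro ⟨x₀, hx₀⟩
  obtain ⟨x, hx, hxp⟩ := hT.exists_solution_near hp hx₀
  have h₁ := hu.above x hx (fun j hj₀ hj => (hxp j hj₀ hj).2) i h₀ hi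
  have h₂ := (hxp i h₀ hi).1
  have : (0 : ℤ) ≤ T.n * T.lcmDiv := by positivity
  omega

/-- Lowering the bound on the target of `e` keeps every tight constraint tight, unless it starts at
that target. -/
theorem Tight.update {T : Table} {u : ℤ → ℤ} {e j t : ℤ} (h : T.Tight u e)
    (hs : T.src e ≠ j) (ht : t ≤ u j) : T.Tight (Function.update u j t) e := by
  unfold Tight newBound at *
  rw [Function.update_of_ne hs]
  rcases eq_or_ne (T.dst e) j with h' | h'
  · rw [h'] at h ⊢; simpa using ht.trans h
  · simpa [h'] using h

end Table

end SolveSDBM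

namespace SolveSDBM

open RAM RAM.Stmt RAM.Expr

/-! ### Bellman-Ford relaxation -/

/-- The memory holds the sizes, the constraints and the strides of `T`. -/
structure Table.Loaded (T : Table) (σ : Store) : Prop where
  n : σ.reg .n = T.n
  m : σ.reg .m = T.m
  src : σ.arr .src = T.src
  dst : σ.arr .dst = T.dst
  wt : σ.arr .wt = T.wt
  d : σ.arr .d = T.d

theorem Table.Loaded.of_frame {T : Table} {s : Stmt} {σ τ : Store} (h : T.Loaded σ)
    (hF : Frame s σ τ) (hs : (s.writesReg .n || s.writesReg .m || s.writesArr .src ||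
      s.writesArr .dst || s.writesArr .wt || s.writesArr .d) = false) : T.Loaded τ := by
  simp only [Bool.or_eq_false_iff] at hs
  obtain ⟨⟨⟨⟨⟨h₁, h₂⟩, h₃⟩, h₄⟩, h₅⟩, h₆⟩ := hs
  exact ⟨(hF.reg _ h₁).trans h.n, (hF.reg _ h₂).trans h.m, (hF.arr _ h₃).trans h.src,
    (hF.arr _ h₄).trans h.dst, (hF.arr _ h₅).trans h.wt, (hF.arr _ h₆).trans h.d⟩

/-- One round of relaxation. -/
def relaxRound : Stmt :=
  forBelow .e Reg.m
    (.t ::= get .p (get .src Reg.e) + get .wt Reg.e ;;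
     ite (.lt Reg.t (get .p (get .dst Reg.e)))
       (store .p (get .dst Reg.e) Reg.t)
       skip)

/-- What a round of relaxation makes of the vector `p`. -/
structure Table.Relaxed (T : Table) (p p' : ℤ → ℤ) (k : ℤ) : Prop where
  le : ∀ i, p' i ≤ p i
  ge : ∀ y, T.Feasible y → (∀ i : ℤ, 0 ≤ i → i < T.n → y i ≤ p i) →
    ∀ i : ℤ, 0 ≤ i → i < T.n → y i ≤ p' i
  done : ∀ e : ℤ, 0 ≤ e → e < k → p' (T.dst e) ≤ p (T.src e) + T.wt e

theorem relaxRound_ends {T : Table} (hT : T.Valid) {σ : Store} (hσ : T.Loaded σ) :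
    Ends relaxRound σ fun t τ =>
      t ≤ T.m * 25 + 6 ∧ T.Relaxed (σ.arr .p) (τ.arr .p) T.m := by
  refine Ends.forBelow 17 (fun k τ => T.Relaxed (σ.arr .p) (τ.arr .p) k) hσ.m (by decide) rfl rfl
    ⟨fun _ => le_rfl, fun y _ h => h, fun e h₀ h => absurd h₀ (by omega)⟩ ?_
  intro k τ hk₀ hk hF hke hI
  have hτ := hσ.of_frame hF rfl
  simp [Cond.Holds, Cond.cost, hke, hτ.src, hτ.dst, hτ.wt]
  refine ⟨fun hlt => ⟨fun i => ?_, fun y hy hyp i hi₀ hi => ?_, fun e he₀ he => ?_⟩,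
    fun hge => ⟨hI.le, hI.ge, fun e he₀ he => ?_⟩⟩
  · have := hI.le i
    rw [Function.update_apply]
    split_ifs with h <;> grind
  · have h₁ := hI.ge y hy hyp
    rw [Function.update_apply]
    split_ifs with h
    · have h₂ := h₁ _ (hT.src_nonneg k hk₀ hk) (hT.src_lt k hk₀ hk)
      have h₃ := hy k hk₀ hk
      rw [h]
      omega
    · exact h₁ i hi₀ hi
  · have h₁ := hI.le (T.src k)
    rw [Function.update_apply]
    rcases eq_or_ne e k with rfl | hne
    · simpa using h₁
    · have h₂ := hI.done e he₀ (by omega)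
      split_ifs with h
      · rw [h] at h₂
        omega
      · exact h₂
  · have h₁ := hI.le (T.src k)
    rcases eq_or_ne e k with rfl | hne
    · omega
    · exact hI.done e he₀ (by omega)

/-- The number of coordinates below `n` at which two vectors differ. -/
noncomputable def numDiff (n : ℕ) (p q : ℤ → ℤ) : ℕ :=
  ((Finset.Ico (0 : ℤ) n).filter fun i => p i ≠ q i).card

theorem numDiff_le (n : ℕ) (p q : ℤ → ℤ) : numDiff n p q ≤ n := by
  simpa [numDiff] using Finset.card_filter_le (Finset.Ico (0 : ℤ) n) fun i => p i ≠ q i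

theorem numDiff_eq_zero {n : ℕ} {p q : ℤ → ℤ} :
    numDiff n p q = 0 ↔ ∀ i : ℤ, 0 ≤ i → i < n → p i = q i := by
  simp [numDiff, Finset.filter_eq_empty_iff]

theorem numDiff_lt {n : ℕ} {p p' q : ℤ → ℤ}
    (h : ∀ i : ℤ, 0 ≤ i → i < n → p i = q i → p' i = q i)
    (h' : ∃ i : ℤ, 0 ≤ i ∧ i < n ∧ p i ≠ q i ∧ p' i = q i) : numDiff n p' q < numDiff n p q := by
  obtain ⟨i, h₀, hi, h₁, h₂⟩ := h'
  refine Finset.card_lt_card (Finset.ssubset_iff_of_subset ?_ |>.2 ⟨i, ?_, ?_⟩)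
  · intro j hj
    simp only [Finset.mem_filter, Finset.mem_Ico] at hj ⊢
    exact ⟨hj.1, fun hp => hj.2 (h j hj.1.1 hj.1.2 hp)⟩
  · simp [h₀, hi, h₁]
  · simp [h₂]

theorem findIntegral_ends {T : Table} (hT : T.Valid) {σ : Store} (hσ : T.Loaded σ) :
    Ends findIntegral σ fun t τ =>
      t ≤ T.n * (T.m * 25 + 25) + T.m * 25 + 25 ∧
      ((τ.reg .sat = 1 ∧ T.Feasible (τ.arr .p)) ∨
        (τ.reg .sat = 0 ∧ ¬ ∃ x, T.Feasible x)) := by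
  unfold findIntegral
  -- the zero vector
  refine Ends.seq (Ends.forBelow 3 (fun k τ => ∀ i : ℤ, 0 ≤ i → i < k → τ.arr .p i = 0) hσ.n
    (by decide) rfl rfl (fun i h₀ h => absurd h₀ (by omega)) ?_) ?_
  · intro k τ hk₀ hk hF hki hI
    simp [hki]
    intro i hi₀ hi
    rw [Function.update_apply]
    split_ifs with h
    · rfl
    · exact hI i hi₀ (by omega)
  rintro t₁ σ₁ hF₁ ⟨ht₁, hp₁⟩
  have hσ₁ := hσ.of_frame hF₁ rfl
  -- after `k` rounds, at most `n - k` coordinates differ from a maximal solution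
  refine Ends.seq (Ends.forBelow (T.m * 25 + 6) (fun k τ =>
    (∀ i : ℤ, 0 ≤ i → i < T.n → τ.arr .p i ≤ 0) ∧
    ∀ δ, T.IsTop δ → (∀ i : ℤ, 0 ≤ i → i < T.n → δ i ≤ τ.arr .p i) ∧
      numDiff T.n (τ.arr .p) δ + k ≤ T.n) hσ₁.n
    (by decide) rfl rfl ⟨?_, ?_⟩ ?_) ?_
  · intro i h₀ hi
    exact (hp₁ i h₀ hi).le
  · intro δ hδ
    refine ⟨fun i h₀ hi => ?_, ?_⟩
    · simpa [hp₁ i h₀ hi] using hδ.nonpos i h₀ hi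
    · have := numDiff_le T.n (σ₁.arr .p) δ
      simpa using this
  · rintro k τ hk₀ hk hF - ⟨hI, hI'⟩
    refine (relaxRound_ends hT (hσ₁.of_frame hF rfl)).mono ?_
    rintro t υ - ⟨ht, hR⟩
    simp only [Store.setReg_arr]
    refine ⟨ht, fun i h₀ hi => (hR.le i).trans (hI i h₀ hi), fun δ hδ => ?_⟩
    obtain ⟨h₁, h₂⟩ := hI' δ hδ
    have h₃ := hR.ge δ hδ.feasible h₁
    refine ⟨h₃, ?_⟩
    have hkeep : ∀ i : ℤ, 0 ≤ i → i < T.n → τ.arr .p i = δ i → υ.arr .p i = δ i := by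
      intro i hi₀ hi h
      have := hR.le i
      have := h₃ i hi₀ hi
      omega
    by_cases hne : ∃ i : ℤ, 0 ≤ i ∧ i < T.n ∧ τ.arr .p i ≠ δ i
    · have := numDiff_lt hkeep (hδ.exists_settled hT hI h₁ h₃ hR.done hne)
      omega
    · push Not at hne
      have : numDiff T.n (υ.arr .p) δ = 0 :=
        numDiff_eq_zero.2 fun i hi₀ hi => hkeep i hi₀ hi (hne i hi₀ hi)
      omega
  rintro t₂ σ₂ hF₂ ⟨ht₂, -, hp₂⟩
  have hσ₂ := hσ₁.of_frame hF₂ rfl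
  have hσ₃ : T.Loaded (σ₂.setReg .sat 1) := ⟨hσ₂.n, hσ₂.m, hσ₂.src, hσ₂.dst, hσ₂.wt, hσ₂.d⟩
  simp only [Ends.seq_iff (s := .set _ _), Ends.set_iff, eval_one, cost_one]
  -- the final check
  refine (Ends.forBelow (s := ite (.lt (get .p (get .src Reg.e) + get .wt Reg.e)
    (get .p (get .dst Reg.e))) (.sat ::= 0) skip) 13 (fun k τ => τ.arr .p = σ₂.arr .p ∧
    ((τ.reg .sat = 1 ∧
      ∀ e : ℤ, 0 ≤ e → e < k → τ.arr .p (T.dst e) ≤ τ.arr .p (T.src e) + T.wt e) ∨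
    (τ.reg .sat = 0 ∧
      ∃ e : ℤ, 0 ≤ e ∧ e < T.m ∧ τ.arr .p (T.src e) + T.wt e < τ.arr .p (T.dst e)))) hσ₃.m
    (by decide) rfl rfl ⟨rfl, Or.inl ⟨by simp, fun e h₀ h => absurd h₀ (by omega)⟩⟩ ?_).mono ?_
  · rintro k τ hk₀ hk hF hke ⟨hp, hI⟩
    have hτ := hσ₃.of_frame hF rfl
    simp [Cond.Holds, Cond.cost, hke, hτ.src, hτ.dst, hτ.wt, hp] at hI ⊢
    refine ⟨fun hlt => ⟨k, hk₀, hk, hlt⟩, fun hge => ?_⟩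
    rcases hI with ⟨h₁, h₂⟩ | h
    · refine Or.inl ⟨h₁, fun e he₀ he => ?_⟩
      rcases eq_or_ne e k with rfl | hne
      · exact hge
      · exact h₂ e he₀ (by omega)
    · exact Or.inr h
  rintro t₃ σ₃ - ⟨ht₃, hp, hI⟩
  refine ⟨?_, ?_⟩
  · nlinarith
  rcases hI with h | ⟨h₁, e, he₀, he, hlt⟩
  · exact Or.inl h
  · refine Or.inr ⟨h₁, ?_⟩
    rintro ⟨x, hx⟩
    obtain ⟨δ, hδ⟩ := Table.exists_isTop hx
    have hcard := (hp₂ δ hδ).2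
    have heq : ∀ i : ℤ, 0 ≤ i → i < T.n → σ₂.arr .p i = δ i := numDiff_eq_zero.1 (by omega)
    rw [hp, heq _ (hT.src_nonneg e he₀ he) (hT.src_lt e he₀ he),
      heq _ (hT.dst_nonneg e he₀ he) (hT.dst_lt e he₀ he)] at hlt
    exact absurd (hδ.feasible e he₀ he) (by omega)

/-! ### The box around an integral solution -/

/-- Euclid's algorithm on the registers `a` and `b`. -/
def euclid : Stmt :=
  loop (.ne Reg.b 0)
    (.t ::= (Reg.a : Expr) % Reg.b ;;
     .a ::= Reg.b ;;
     .b ::= Reg.t)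

/-- Each pass replaces `b` by a remainder modulo `b`, so there are at most `|b|` passes. -/
theorem euclid_ends (σ : Store) :
    Ends euclid σ fun t τ =>
      t ≤ (σ.reg .b).natAbs * 12 + 4 ∧
        (τ.reg .a).natAbs = Int.gcd (σ.reg .a) (σ.reg .b) := by
  refine (Ends.loop (fun τ =>
    Int.gcd (τ.reg .a) (τ.reg .b) = Int.gcd (σ.reg .a) (σ.reg .b))
    (fun τ => (τ.reg .b).natAbs * 12) rfl ?_).mono ?_
  · rintro τ - hc hg
    simp [Cond.Holds] at hc
    simp [Cond.cost]
    refine ⟨?_, ?_⟩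
    · exact (Int.gcd_comm _ _).trans ((Int.gcd_emod _ _).trans hg)
    · have h₁ := Int.emod_nonneg (τ.reg .a) hc
      have h₂ := Int.emod_lt_abs (τ.reg .a) hc
      rw [Int.abs_eq_natAbs] at h₂
      omega
  · rintro t τ - ⟨hg, hc, ht⟩
    simp [Cond.Holds] at hc
    simp [hc] at hg
    simp [Cond.cost] at ht
    exact ⟨by omega, hg⟩

theorem computeLcm_ends {T : Table} (hT : T.Valid) {σ : Store} (hn : σ.reg .n = T.n)
    (hd : ∀ i : ℤ, 0 ≤ i → i < T.n → σ.arr .d i = T.d i) :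
    Ends computeLcm σ fun t τ =>
      t ≤ T.n * (T.lcmDiv * 12 + 40) + 8 ∧ τ.reg .lcm = T.lcmDiv := by
  unfold computeLcm
  simp only [Ends.seq_iff (s := .set .lcm _), Ends.set_iff, eval_one, cost_one]
  refine (Ends.forBelow (T.lcmDiv * 12 + 30)
    (fun k τ => τ.reg .lcm = T.lcmBelow k) (σ₀ := σ.setReg .lcm 1)
    (by simpa using hn) (by decide) rfl rfl (by simp [Table.lcmBelow_zero]) ?_).mono ?_
  · intro k τ hk₀ hk hF hki hI
    have hτd : τ.arr .d k = T.d k := by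
      rw [hF.arr .d rfl]
      exact hd k hk₀ hk
    simp only [Ends.seq_iff (s := .set _ _), Ends.set_iff]
    refine Ends.seq (euclid_ends _) ?_
    rintro t υ hFυ ⟨ht, ha⟩
    have h₁ : υ.reg .lcm = T.lcmBelow k := by rw [hFυ.reg .lcm rfl]; simpa using hI
    have h₂ : υ.reg .i = k := by rw [hFυ.reg .i rfl]; simpa using hki
    have h₃ : υ.arr .d k = T.d k := by rw [hFυ.arr .d rfl]; simpa using hτd
    have hdk := hT.natAbs_d_le hk₀ hk
    simp [hki, hτd, hI] at ht ha
    have hval : (T.lcmBelow k * (T.d k / υ.reg .a)).natAbs = T.lcmBelow (k + 1) := by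
      rw [T.lcmBelow_succ hk₀, Int.natAbs_mul, Int.natAbs_natCast, Int.natAbs_ediv_of_dvd, ha,
        Nat.lcm, Nat.mul_div_assoc]
      · rfl
      · exact Nat.gcd_dvd_right _ _
      · rw [← Int.natAbs_dvd_natAbs, ha]
        exact Nat.gcd_dvd_right _ _
    simp [Cond.Holds, Cond.cost, h₁, h₂, h₃]
    refine ⟨fun h => ⟨by omega, by omega⟩, fun h => ⟨by omega, by omega⟩⟩
  · rintro t τ - ⟨ht, hl⟩
    exact ⟨by nlinarith, hl⟩

/-- The state of the memory when the propagation starts. -/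
structure Table.Boxed (T : Table) (p : ℤ → ℤ) (σ : Store) : Prop where
  loaded : T.Loaded σ
  sat : σ.reg .sat = 1
  lo : ∀ i : ℤ, 0 ≤ i → i < T.n → σ.arr .lo i = p i - T.n * T.lcmDiv
  up : T.UpperBounds p (σ.arr .up)
  lo_le_up : ∀ i : ℤ, 0 ≤ i → i < T.n → σ.arr .lo i ≤ σ.arr .up i

theorem box_ends {T : Table} (hT : T.Valid) {σ : Store} (hσ : T.Loaded σ) :
    Ends box σ fun t τ =>
      t ≤ T.n * (T.lcmDiv * 12 + 100) + 30 ∧ T.Boxed (σ.arr .p) τ := by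
  unfold box
  refine Ends.seq (computeLcm_ends hT hσ.n fun i _ _ => by rw [hσ.d]) ?_
  rintro t₁ σ₁ hF₁ ⟨ht₁, hl⟩
  have hσ₁ := hσ.of_frame hF₁ rfl
  have hp₁ : σ₁.arr .p = σ.arr .p := hF₁.arr .p rfl
  refine Ends.seq (Ends.forBelow 16 (fun k τ => ∀ i : ℤ, 0 ≤ i → i < k →
    τ.arr .lo i = σ.arr .p i - T.n * T.lcmDiv ∧ τ.arr .up i = σ.arr .p i + T.n * T.lcmDiv) hσ₁.n
    (by decide) rfl rfl (fun i h₀ h => absurd h₀ (by omega)) ?_) ?_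
  · intro k τ hk₀ hk hF hki hI
    have hτ := hσ₁.of_frame hF rfl
    have hτp : τ.arr .p = σ.arr .p := (hF.arr .p rfl).trans hp₁
    have hτl : τ.reg .lcm = T.lcmDiv := (hF.reg .lcm rfl).trans hl
    simp [hki, hτ.n, hτp, hτl]
    intro i hi₀ hi
    rcases eq_or_ne i k with rfl | hne
    · simp
    · simpa [hne] using hI i hi₀ (by omega)
  rintro t₂ σ₂ hF₂ ⟨ht₂, hb₂⟩
  have hσ₂ := hσ₁.of_frame hF₂ rfl
  refine Ends.seq (Ends.forBelow 14 (fun k τ => ∀ i : ℤ, 0 ≤ i → i < T.n →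
    τ.arr .up i = if i < k then T.d i * (σ₂.arr .up i / T.d i) else σ₂.arr .up i) hσ₂.n
    (by decide) rfl rfl (fun i h₀ h => by simp [h₀]) ?_) ?_
  · intro k τ hk₀ hk hF hki hI
    have hτ := hσ₂.of_frame hF rfl
    simp [hki, roundDown, hτ.d]
    intro i hi₀ hi
    rcases eq_or_ne i k with rfl | hne
    · simp [hI i hi₀ hi]
    · have : i ≤ k ↔ i < k := by omega
      simp [hne, hI i hi₀ hi, this]
  rintro t₃ σ₃ hF₃ ⟨ht₃, hb₃⟩
  have hσ₃ := hσ₂.of_frame hF₃ rfl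
  have hup : ∀ i : ℤ, 0 ≤ i → i < T.n →
      σ₃.arr .up i = T.d i * ((σ.arr .p i + T.n * T.lcmDiv) / T.d i) := fun i h₀ hi => by
    rw [hb₃ i h₀ hi, if_pos hi, (hb₂ i h₀ hi).2]
  have hlo : ∀ i : ℤ, 0 ≤ i → i < T.n → σ₃.arr .lo i = σ.arr .p i - T.n * T.lcmDiv :=
    fun i h₀ hi => by rw [hF₃.arr .lo rfl, (hb₂ i h₀ hi).1]
  simp only [Ends.set_iff, eval_one, cost_one]
  refine ⟨by nlinarith, ⟨hσ₃.n, hσ₃.m, hσ₃.src, hσ₃.dst, hσ₃.wt, hσ₃.d⟩, by simp, hlo,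
    ⟨fun i h₀ hi => ?_, fun i h₀ hi => ?_, fun x hx hxp i h₀ hi => ?_⟩, fun i h₀ hi => ?_⟩
  · simp [hup i h₀ hi]
  · simp only [Store.setReg_arr, hup i h₀ hi]
    exact Int.mul_ediv_self_le (hT.d_ne_zero i h₀ hi)
  · simp only [Store.setReg_arr, hup i h₀ hi]
    exact Table.le_roundDown (hT.d_ne_zero i h₀ hi) (hx.2 i h₀ hi) (hxp i h₀ hi)
  · simp only [Store.setReg_arr, hup i h₀ hi, hlo i h₀ hi]
    have h₁ := Int.mul_ediv_add_emod (σ.arr .p i + T.n * T.lcmDiv) (T.d i)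
    have h₂ := Int.emod_lt_abs (σ.arr .p i + T.n * T.lcmDiv) (hT.d_ne_zero i h₀ hi)
    have h₃ := hT.natAbs_d_le h₀ hi
    have h₄ : (T.lcmDiv : ℤ) ≤ T.n * T.lcmDiv := by
      have : (1 : ℤ) ≤ T.n := by omega
      nlinarith
    rw [Int.abs_eq_natAbs] at h₂
    omega

/-! ### Propagation by sweeps -/

/-- The memory during the propagation from the box around `p`; `sat` says whether the upper bounds
are still above the lower ends of the box. -/
structure Table.Propagating (T : Table) (p : ℤ → ℤ) (σ : Store) : Prop where
  loaded : T.Loaded σ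
  lo : ∀ i : ℤ, 0 ≤ i → i < T.n → σ.arr .lo i = p i - T.n * T.lcmDiv
  up : T.UpperBounds p (σ.arr .up)
  sat : (σ.reg .sat = 1 ∧ ∀ i : ℤ, 0 ≤ i → i < T.n → σ.arr .lo i ≤ σ.arr .up i) ∨
    (σ.reg .sat = 0 ∧ ∃ i : ℤ, 0 ≤ i ∧ i < T.n ∧ σ.arr .up i < σ.arr .lo i)

theorem Table.Propagating.lo_le_up {T : Table} {p : ℤ → ℤ} {σ : Store} (h : T.Propagating p σ)
    (hs : σ.reg .sat = 1) {i : ℤ} (h₀ : 0 ≤ i) (hi : i < T.n) : σ.arr .lo i ≤ σ.arr .up i := by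
  rcases h.sat with h | h
  · exact h.2 i h₀ hi
  · omega

theorem Table.Boxed.propagating {T : Table} {p : ℤ → ℤ} {σ : Store} (h : T.Boxed p σ) :
    T.Propagating p σ :=
  ⟨h.loaded, h.lo, h.up, Or.inl ⟨h.sat, h.lo_le_up⟩⟩

/-- The relevant part of the memory is left alone. -/
theorem Table.Propagating.congr {T : Table} {p : ℤ → ℤ} {σ τ : Store} (h : T.Propagating p σ)
    (hτ : T.Loaded τ) (hlo : τ.arr .lo = σ.arr .lo) (hup : τ.arr .up = σ.arr .up)
    (hsat : τ.reg .sat = σ.reg .sat) : T.Propagating p τ :=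
  ⟨hτ, by rw [hlo]; exact h.lo, by rw [hup]; exact h.up, by rw [hlo, hup, hsat]; exact h.sat⟩

/-- Constraint `e` lowers the bound on its target. -/
theorem Table.Propagating.update {T : Table} (hT : T.Valid) {p : ℤ → ℤ} {σ τ : Store}
    (h : T.Propagating p σ) (hs : σ.reg .sat = 1) (hτ : T.Loaded τ) {e : ℤ} (h₀ : 0 ≤ e)
    (he : e < T.m) (hlt : T.newBound (σ.arr .up) e < σ.arr .up (T.dst e))
    (hlo : τ.arr .lo = σ.arr .lo)
    (hup : τ.arr .up =
      Function.update (σ.arr .up) (T.dst e) (T.newBound (σ.arr .up) e))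
    (hsat : τ.reg .sat = if T.newBound (σ.arr .up) e < σ.arr .lo (T.dst e) then 0 else 1) :
    T.Propagating p τ := by
  refine ⟨hτ, by rw [hlo]; exact h.lo, by rw [hup]; exact h.up.update hT h₀ he hlt, ?_⟩
  rw [hlo, hup, hsat]
  split_ifs with hc
  · exact Or.inr ⟨rfl, T.dst e, hT.dst_nonneg e h₀ he, hT.dst_lt e h₀ he, by simpa using hc⟩
  · refine Or.inl ⟨rfl, fun i hi₀ hi => ?_⟩
    rcases eq_or_ne i (T.dst e) with rfl | hne
    · simpa using hc
    · simpa [hne] using h.lo_le_up hs hi₀ hi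

/-- What the propagation from the box around `p` has to return. -/
def Table.Answer (T : Table) (p : ℤ → ℤ) (σ : Store) : Prop :=
  (σ.reg .sat = 1 ∧ T.Solves (σ.arr .up) ∧
    ∀ i : ℤ, 0 ≤ i → i < T.n → |σ.arr .up i - p i| ≤ T.n * T.lcmDiv) ∨
  (σ.reg .sat = 0 ∧ ¬ ∃ x, T.Solves x)

theorem Table.Propagating.answer {T : Table} (hT : T.Valid) {p : ℤ → ℤ} {σ : Store}
    (h : T.Propagating p σ) (hp : T.Feasible p)
    (htight : σ.reg .sat = 1 → ∀ e : ℤ, 0 ≤ e → e < T.m → T.Tight (σ.arr .up) e) :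
    T.Answer p σ := by
  rcases h.sat with ⟨hs, hle⟩ | ⟨hs, i, h₀, hi, hlt⟩
  · refine Or.inl ⟨hs, h.up.solves hT (htight hs), fun i h₀ hi => ?_⟩
    have h₁ := hle i h₀ hi
    have h₂ := h.up.le i h₀ hi
    rw [h.lo i h₀ hi] at h₁
    exact abs_le.2 ⟨by omega, by omega⟩
  · exact Or.inr ⟨hs, h.up.not_solves hT hp h₀ hi (by rwa [h.lo i h₀ hi] at hlt)⟩

/-- The potential that pays for the propagation: the number of times the bounds `u` can still be
lowered, where lowering the bound on `i` counts `w i`-fold. -/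
noncomputable def slack (n : ℕ) (w : ℤ → ℕ) (lo u : ℤ → ℤ) : ℕ :=
  ∑ i ∈ Finset.Ico (0 : ℤ) n, w i * (u i - lo i + 1).toNat

theorem slack_update {n : ℕ} (w : ℤ → ℕ) {lo u : ℤ → ℤ} {j t : ℤ} (h₀ : 0 ≤ j) (hj : j < n)
    (ht : t < u j) (hlo : lo j ≤ u j) :
    slack n w lo (Function.update u j t) + w j ≤ slack n w lo u := by
  have hmem : j ∈ Finset.Ico (0 : ℤ) n := Finset.mem_Ico.2 ⟨h₀, hj⟩
  unfold slack
  rw [← Finset.add_sum_erase _ _ hmem, ← Finset.add_sum_erase _ (fun i => _ * _) hmem]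
  have h₁ : ∑ i ∈ (Finset.Ico (0 : ℤ) n).erase j,
      w i * (Function.update u j t i - lo i + 1).toNat =
      ∑ i ∈ (Finset.Ico (0 : ℤ) n).erase j, w i * (u i - lo i + 1).toNat :=
    Finset.sum_congr rfl fun i hi => by rw [Function.update_of_ne (Finset.ne_of_mem_erase hi)]
  have h₂ : w j * (t - lo j + 1).toNat + w j ≤ w j * (u j - lo j + 1).toNat := by
    rw [← Nat.mul_succ]
    exact Nat.mul_le_mul_left _ (by omega)
  simp only [Function.update_self]
  omega

theorem Table.Propagating.slack_le {T : Table} {p : ℤ → ℤ} {σ : Store}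
    (h : T.Propagating p σ) (w : ℤ → ℕ) :
    slack T.n w (σ.arr .lo) (σ.arr .up) ≤
      (∑ i ∈ Finset.Ico (0 : ℤ) T.n, w i) * (2 * (T.n * T.lcmDiv) + 1) := by
  unfold slack
  rw [Finset.sum_mul]
  refine Finset.sum_le_sum fun i hi => Nat.mul_le_mul_left _ ?_
  rw [Finset.mem_Ico] at hi
  have h₁ := h.up.le i hi.1 hi.2
  have h₂ := h.lo i hi.1 hi.2
  have h₃ : (0 : ℤ) ≤ T.n * T.lcmDiv := by positivity
  zify
  omega

/-- One pass over all constraints. -/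
def sweepOnce : Stmt :=
  loop (.and (.lt Reg.e Reg.m) (.eq Reg.sat 1))
    (.j ::= get .dst Reg.e ;;
     .t ::= newBound Reg.e ;;
     ite (.lt Reg.t (get .up Reg.j))
       (store .up Reg.j Reg.t ;;
        .changed ::= 1 ;;
        ite (.lt Reg.t (get .lo Reg.j)) (.sat ::= 0) skip)
       skip ;;
     .e ::= (Reg.e : Expr) + 1)

/-- The state during a sweep that started at `σ`: either no bound has changed and the constraints
seen so far are tight, or some potential has been used up. -/
structure Table.Sweeping (T : Table) (p : ℤ → ℤ) (σ τ : Store) : Prop where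
  propagating : T.Propagating p τ
  nonneg : 0 ≤ τ.reg .e
  le : τ.reg .e ≤ T.m
  changed : (τ.reg .changed = 0 ∧ τ.reg .sat = 1 ∧ τ.arr .lo = σ.arr .lo ∧
      τ.arr .up = σ.arr .up ∧ ∀ e : ℤ, 0 ≤ e → e < τ.reg .e → T.Tight (τ.arr .up) e) ∨
    (τ.reg .changed = 1 ∧ slack T.n (fun _ => 1) (τ.arr .lo) (τ.arr .up) <
      slack T.n (fun _ => 1) (σ.arr .lo) (σ.arr .up))

/-- A sweep that changes something uses up some of the potential. -/
theorem sweepOnce_ends {T : Table} (hT : T.Valid) {p : ℤ → ℤ} {σ : Store}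
    (hσ : T.Propagating p σ) (he : σ.reg .e = 0) (hc : σ.reg .changed = 0)
    (hs : σ.reg .sat = 1) :
    Ends sweepOnce σ fun t τ => t ≤ T.m * 50 + 9 ∧ T.Propagating p τ ∧
      ((τ.reg .changed = 0 ∧ ∀ e : ℤ, 0 ≤ e → e < T.m → T.Tight (τ.arr .up) e) ∨
       (τ.reg .changed = 1 ∧ slack T.n (fun _ => 1) (τ.arr .lo) (τ.arr .up) <
          slack T.n (fun _ => 1) (σ.arr .lo) (σ.arr .up))) := by
  refine (Ends.loop (T.Sweeping p σ) (fun τ => (T.m - τ.reg .e).toNat * 50)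
    ⟨hσ, by omega, by omega, Or.inl ⟨hc, hs, rfl, rfl, fun e h₀ h => by omega⟩⟩ ?_).mono ?_
  · rintro τ hF hcond ⟨hτ, hk₀, -, hI⟩
    have hL := hτ.loaded
    simp [Cond.Holds, hL.m] at hcond
    obtain ⟨hk, hsat⟩ := hcond
    generalize hke : τ.reg .e = k at *
    have hnb : T.d (T.dst k) * ((τ.arr .up (T.src k) + T.wt k) / T.d (T.dst k)) =
      T.newBound (τ.arr .up) k := rfl
    by_cases hlt : T.newBound (τ.arr .up) k < τ.arr .up (T.dst k)
    · have hsl := slack_update (fun _ => 1) (hT.dst_nonneg k hk₀ hk) (hT.dst_lt k hk₀ hk) hlt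
        (hτ.lo_le_up hsat (hT.dst_nonneg k hk₀ hk) (hT.dst_lt k hk₀ hk))
      have hsl' : slack T.n (fun _ => 1) (τ.arr .lo) (τ.arr .up) ≤
          slack T.n (fun _ => 1) (σ.arr .lo) (σ.arr .up) := by
        rcases hI with ⟨-, -, h₁, h₂, -⟩ | ⟨-, h⟩
        · rw [h₁, h₂]
        · exact h.le
      by_cases hlo : T.newBound (τ.arr .up) k < τ.arr .lo (T.dst k)
      all_goals
        simp only [Ends.seq_iff, Ends.ite_iff, Ends.set_iff, Ends.store_iff, Ends.skip_iff]
        simp [Cond.Holds, Cond.cost, hke, hL.src, hL.dst, hL.wt, hL.d, newBound, roundDown, hnb,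
          hlt, hlo]
        refine ⟨⟨?_, by simp; omega, by simp; omega, Or.inr ⟨by simp, by simp; omega⟩⟩, by omega⟩
        refine hτ.update hT hsat (e := k) ?_ hk₀ hk hlt ?_ ?_ ?_
        · constructor <;> simp [hL.n, hL.m, hL.src, hL.dst, hL.wt, hL.d]
        · simp
        · simp
        · simp [hlo, hsat]
    · simp only [Ends.seq_iff, Ends.ite_iff, Ends.set_iff, Ends.store_iff, Ends.skip_iff]
      simp [Cond.Holds, Cond.cost, hke, hL.src, hL.dst, hL.wt, hL.d, newBound, roundDown, hnb, hlt]
      refine ⟨⟨?_, by simp; omega, by simp; omega, ?_⟩, by omega⟩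
      · refine hτ.congr ?_ ?_ ?_ ?_
        · constructor <;> simp [hL.n, hL.m, hL.src, hL.dst, hL.wt, hL.d]
        all_goals simp
      · rcases hI with ⟨h₁, h₂, h₃, h₄, h₅⟩ | h
        · refine Or.inl ⟨by simpa using h₁, by simpa using h₂, by simpa using h₃,
            by simpa using h₄, fun e he₀ he => ?_⟩
          rcases eq_or_ne e k with rfl | hne
          · exact not_lt.1 hlt
          · exact h₅ e he₀ (by simp at he; omega)
        · exact Or.inr (by simpa using h)
  · rintro t τ - ⟨⟨hτ, hk₀, hk, hI⟩, hcond, ht⟩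
    simp [Cond.Holds, hτ.loaded.m] at hcond
    simp [Cond.cost, he] at ht
    refine ⟨by omega, hτ, ?_⟩
    rcases hI with ⟨h₁, h₂, h₃, h₄, h₅⟩ | h
    · have : τ.reg .e = T.m := by
        by_contra hne
        exact hcond (by omega) h₂
      rw [this] at h₅
      exact Or.inl ⟨h₁, h₅⟩
    · exact Or.inr h

theorem sweep_ends {T : Table} (hT : T.Valid) {p : ℤ → ℤ} (hp : T.Feasible p) {σ : Store}
    (hσ : T.Boxed p σ) :
    Ends sweep σ fun t τ =>
      t ≤ (T.n * (2 * (T.n * T.lcmDiv) + 1) + 1) * (T.m * 50 + 30) + 10 ∧ T.Answer p τ := by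
  have hbound := hσ.propagating.slack_le fun _ => 1
  simp only [Finset.sum_const, Int.card_Ico, sub_zero, Int.toNat_natCast, smul_eq_mul,
    mul_one] at hbound
  unfold sweep
  simp only [Ends.seq_iff (s := .set .changed _), Ends.set_iff, eval_one, cost_one]
  refine (Ends.loop (fun τ => T.Propagating p τ ∧ (τ.reg .changed = 1 ∨
      (τ.reg .changed = 0 ∧ ∀ e : ℤ, 0 ≤ e → e < T.m → T.Tight (τ.arr .up) e)))
    (fun τ => if τ.reg .changed = 1 then
      (slack T.n (fun _ => 1) (τ.arr .lo) (τ.arr .up) + 1) * (T.m * 50 + 30) else 0)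
    ⟨?_, Or.inl (by simp)⟩ ?_).mono ?_
  · have hL := hσ.loaded
    refine hσ.propagating.congr ?_ ?_ ?_ ?_
    · constructor <;> simp [hL.n, hL.m, hL.src, hL.dst, hL.wt, hL.d]
    all_goals simp
  · rintro τ - hcond ⟨hτ, hI⟩
    simp [Cond.Holds] at hcond
    simp only [Ends.seq_iff (s := .set _ _), Ends.set_iff]
    have hL := hτ.loaded
    refine (sweepOnce_ends hT (p := p) (hτ.congr ?_ ?_ ?_ ?_) ?_ ?_ ?_).mono ?_
    · constructor <;> simp [hL.n, hL.m, hL.src, hL.dst, hL.wt, hL.d]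
    any_goals simp [hcond]
    rintro t υ - ht hυ hI'
    rcases hI' with ⟨h₁, h₂⟩ | ⟨h₁, h₂⟩
    · refine ⟨⟨hυ, Or.inr ⟨h₁, h₂⟩⟩, ?_⟩
      simp [Cond.cost, h₁]
      nlinarith
    · refine ⟨⟨hυ, Or.inl h₁⟩, ?_⟩
      simp [Cond.cost, h₁]
      nlinarith
  · rintro t τ - ⟨⟨hτ, hI⟩, hcond, ht⟩
    simp [Cond.Holds] at hcond
    simp [Cond.cost] at ht
    refine ⟨?_, hτ.answer hT hp fun hs => ?_⟩
    · have := Nat.mul_le_mul_right (T.m * 50 + 30) (Nat.add_le_add_right hbound 1)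
      omega
    · rcases hI with h | h
      · exact absurd hs (hcond h)
      · exact h.2

/-! ### Propagation with a worklist -/

/-- `c - 1` is the last constraint below `k` with source `i`; `c = 0` if there is none. -/
structure IsLast (src : ℤ → ℤ) (i k c : ℤ) : Prop where
  nonneg : 0 ≤ c
  le : c ≤ k
  src_eq : c = 0 ∨ src (c - 1) = i
  none_above : ∀ e : ℤ, c ≤ e → e < k → src e ≠ i

/-- The linked lists of constraints: the list of variable `i` holds the constraints with source `i`
in decreasing order. -/
structure Table.Linked (T : Table) (σ : Store) : Prop where
  head : ∀ i : ℤ, 0 ≤ i → i < T.n → IsLast T.src i T.m (σ.arr .head i)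
  next : ∀ e : ℤ, 0 ≤ e → e < T.m → IsLast T.src (T.src e) e (σ.arr .next e)

theorem buildAdjacency_ends {T : Table} (hT : T.Valid) {σ : Store} (hσ : T.Loaded σ) :
    Ends buildAdjacency σ fun t τ => t ≤ T.n * 11 + T.m * 30 + 12 ∧ T.Linked τ := by
  unfold buildAdjacency
  refine Ends.seq (Ends.forBelow 3 (fun k τ => ∀ i : ℤ, 0 ≤ i → i < k → τ.arr .head i = 0) hσ.n
    (by decide) rfl rfl (fun i h₀ h => absurd h₀ (by omega)) ?_) ?_
  · intro k τ hk₀ hk hF hki hI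
    simp [hki]
    intro i hi₀ hi
    rw [Function.update_apply]
    split_ifs with h
    · rfl
    · exact hI i hi₀ (by omega)
  rintro t₁ σ₁ hF₁ ⟨ht₁, hh₁⟩
  have hσ₁ := hσ.of_frame hF₁ rfl
  refine (Ends.forBelow 15 (fun k τ =>
    (∀ i : ℤ, 0 ≤ i → i < T.n → IsLast T.src i k (τ.arr .head i)) ∧
    (∀ e : ℤ, 0 ≤ e → e < k → IsLast T.src (T.src e) e (τ.arr .next e))) hσ₁.m
    (by decide) rfl rfl ⟨fun i h₀ hi => ?_, fun i h₀ h => absurd h₀ (by omega)⟩ ?_).mono ?_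
  · rw [Store.setReg_arr, hh₁ i h₀ hi]
    exact ⟨le_rfl, le_rfl, Or.inl rfl, fun e h h' => by omega⟩
  · rintro k τ hk₀ hk hF hke ⟨hI, hI'⟩
    have hτ := hσ₁.of_frame hF rfl
    simp [hke, hτ.src]
    refine ⟨fun i hi₀ hi => ?_, fun e he₀ he => ?_⟩
    · rcases eq_or_ne i (T.src k) with rfl | hne
      · simp only [Function.update_self]
        exact ⟨by omega, by omega, Or.inr (by simp), fun e h h' => by omega⟩
      · rw [Function.update_of_ne hne]
        have h := hI i hi₀ hi
        refine ⟨h.nonneg, by have := h.le; omega, h.src_eq, fun e h₁ h₂ => ?_⟩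
        rcases eq_or_ne e k with rfl | hek
        · exact hne.symm
        · exact h.none_above e h₁ (by omega)
    · rcases eq_or_ne e k with rfl | hek
      · simpa using hI _ (hT.src_nonneg e hk₀ hk) (hT.src_lt e hk₀ hk)
      · rw [Function.update_of_ne hek]
        exact hI' e he₀ (by omega)
  · rintro t τ - ⟨ht, hI⟩
    exact ⟨by omega, hI.1, hI.2⟩

/-- The number of constraints below `c` with source `i`. -/
noncomputable def Table.outBelow (T : Table) (i c : ℤ) : ℕ :=
  ((Finset.Ico 0 c).filter fun e => T.src e = i).card

theorem Table.outBelow_mono (T : Table) (i : ℤ) {c c' : ℤ} (h : c ≤ c') :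
    T.outBelow i c ≤ T.outBelow i c' :=
  Finset.card_le_card
    (Finset.filter_subset_filter _ (Finset.Ico_subset_Ico_right h))

theorem Table.outBelow_lt (T : Table) {e c : ℤ} (h₀ : 0 ≤ e) (hc : c ≤ e) :
    T.outBelow (T.src e) c + 1 ≤ T.outBelow (T.src e) (e + 1) := by
  refine Finset.card_lt_card ?_
  rw [Finset.ssubset_iff_of_subset]
  · exact ⟨e, by simp [h₀], by simp [hc]⟩
  · exact Finset.filter_subset_filter _ (Finset.Ico_subset_Ico_right (by omega))

theorem Table.sum_outBelow_le (T : Table) :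
    ∑ i ∈ Finset.Ico (0 : ℤ) T.n, T.outBelow i T.m ≤ T.m := by
  unfold outBelow
  rw [← Finset.card_biUnion]
  · refine (Finset.card_le_card (Finset.biUnion_subset.2 fun i _ =>
      Finset.filter_subset _ _)).trans ?_
    simp
  · intro i _ j _ hij
    refine Finset.disjoint_filter.2 fun e _ h h' => hij (h.symm.trans h')

/-- The sum of `f` over the first `top` entries of the pool. -/
noncomputable def poolSum (f : ℤ → ℕ) (pool : ℤ → ℤ) (top : ℤ) : ℕ := ∑ k ∈ Finset.Ico 0 top, f (pool k)

theorem poolSum_succ (f : ℤ → ℕ) (pool : ℤ → ℤ) {top : ℤ} (h : 0 ≤ top) :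
    poolSum f pool (top + 1) = poolSum f pool top + f (pool top) := by
  have : Finset.Ico 0 (top + 1) = insert top (Finset.Ico 0 top) := by
    ext; simp only [Finset.mem_insert, Finset.mem_Ico]; omega
  rw [poolSum, this, Finset.sum_insert (by simp), poolSum, add_comm]

theorem poolSum_update_of_le (f : ℤ → ℕ) (pool : ℤ → ℤ) {top k v : ℤ} (h : top ≤ k) :
    poolSum f (Function.update pool k v) top = poolSum f pool top := by
  refine Finset.sum_congr rfl fun i hi => ?_
  rw [Finset.mem_Ico] at hi
  rw [Function.update_of_ne (by omega)]

/-- Removing entry `k` from the pool by moving the last entry into its place. -/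
theorem poolSum_remove (f : ℤ → ℕ) (pool : ℤ → ℤ) {top k : ℤ} (h₀ : 0 ≤ k) (hk : k < top) :
    poolSum f (Function.update pool k (pool (top - 1))) (top - 1) + f (pool k) =
      poolSum f pool top := by
  have h := poolSum_succ f pool (top := top - 1) (by omega)
  rw [sub_add_cancel] at h
  rw [h]
  rcases eq_or_ne k (top - 1) with rfl | hne
  · rw [poolSum_update_of_le _ _ le_rfl]
  · have hmem : k ∈ Finset.Ico 0 (top - 1) := Finset.mem_Ico.2 ⟨h₀, by omega⟩
    unfold poolSum
    rw [← Finset.add_sum_erase _ _ hmem, ← Finset.add_sum_erase _ (fun i => f (pool i)) hmem,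
      Finset.sum_congr rfl fun i hi => by rw [Function.update_of_ne (Finset.ne_of_mem_erase hi)],
      Function.update_self]
    omega

/-- The memory during the propagation with a worklist. A constraint that is not tight starts at a
dirty variable or is `pending`. An entry may stay in the pool while its flag is `0`, which does no
harm. -/
structure Table.Working (T : Table) (p : ℤ → ℤ) (pending : ℤ → Prop) (σ : Store) : Prop where
  propagating : T.Propagating p σ
  linked : T.Linked σ
  top_nonneg : 0 ≤ σ.reg .top
  pool : ∀ k : ℤ, 0 ≤ k → k < σ.reg .top → 0 ≤ σ.arr .pool k ∧ σ.arr .pool k < T.n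
  mem_pool : ∀ i : ℤ, 0 ≤ i → i < T.n → σ.arr .inDirty i ≠ 0 →
    ∃ k : ℤ, 0 ≤ k ∧ k < σ.reg .top ∧ σ.arr .pool k = i
  tight : σ.reg .sat = 1 → ∀ e : ℤ, 0 ≤ e → e < T.m →
    T.Tight (σ.arr .up) e ∨ σ.arr .inDirty (T.src e) ≠ 0 ∨ pending e

/-- The potential that pays for the worklist version. An entry of the pool pays for its removal and
for looking at the constraints of the variable. Each look at a constraint can afford the removal of
the one entry that it may add, and the scan of that entry is paid by the decrease of its bound. -/
noncomputable def Table.credit (T : Table) (σ : Store) : ℕ :=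
  poolSum (fun i => 40 + 120 * T.outBelow i T.m) (σ.arr .pool) (σ.reg .top) +
    slack T.n (fun i => 120 * T.outBelow i T.m) (σ.arr .lo) (σ.arr .up)

/-- The scan of the constraints that leave the chosen dirty variable. -/
def scan : Stmt :=
  loop (.and (.ne Reg.e 0) (.eq Reg.sat 1))
    (.j ::= get .dst ((Reg.e : Expr) - 1) ;;
     .t ::= newBound ((Reg.e : Expr) - 1) ;;
     ite (.lt Reg.t (get .up Reg.j))
       (store .up Reg.j Reg.t ;;
        ite (.lt Reg.t (get .lo Reg.j)) (.sat ::= 0)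
          (ite (.eq (get .inDirty Reg.j) 0)
            (store .inDirty Reg.j 1 ;;
             store .pool Reg.top Reg.j ;;
             .top ::= (Reg.top : Expr) + 1)
            skip))
       skip ;;
     .e ::= get .next ((Reg.e : Expr) - 1))

/-- The state during the scan of variable `i`: the constraints not yet looked at are pending. -/
structure Table.Scanning (T : Table) (p : ℤ → ℤ) (i : ℤ) (σ : Store) : Prop where
  working : T.Working p (fun e => T.src e = i ∧ e < σ.reg .e) σ
  nonneg : 0 ≤ σ.reg .e
  le : σ.reg .e ≤ T.m
  src_eq : σ.reg .e = 0 ∨ T.src (σ.reg .e - 1) = i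

/-- After lowering the bound on the target `j` of constraint `k`, all constraints that do not start
at `j` are as tight as before, and `k` is tight. -/
theorem Table.tight_update {T : Table} {u : ℤ → ℤ} {k e : ℤ}
    (h : T.Tight u e ∨ e = k) (hs : T.src e ≠ T.dst k) (hlt : T.newBound u k < u (T.dst k)) :
    T.Tight (Function.update u (T.dst k) (T.newBound u k)) e := by
  rcases h with h | rfl
  · exact h.update hs hlt.le
  · simp [Table.Tight, Table.newBound, Function.update_of_ne hs]

theorem scan_ends {T : Table} (hT : T.Valid) {p : ℤ → ℤ} {σ : Store} {i : ℤ}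
    (hσ : T.Scanning p i σ) :
    Ends scan σ fun t τ => T.Working p (fun _ => False) τ ∧
      t + T.credit τ ≤ 120 * T.outBelow i T.m + T.credit σ + 8 := by
  refine (Ends.loop (T.Scanning p i) (fun τ => 120 * T.outBelow i (τ.reg .e) + T.credit τ)
    hσ ?_).mono ?_
  · rintro τ hF hcond ⟨hW, hc₀, hcm, hci⟩
    have hτ := hW.propagating
    have hL := hτ.loaded
    simp [Cond.Holds] at hcond
    obtain ⟨hc, hsat⟩ := hcond
    obtain ⟨k, hke⟩ : ∃ k, τ.reg .e = k + 1 := ⟨τ.reg .e - 1, by omega⟩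
    have hk₀ : 0 ≤ k := by omega
    have hk : k < T.m := by omega
    obtain rfl : T.src k = i := by
      have := hci.resolve_left hc
      rwa [hke, add_sub_cancel_right] at this
    have hnext := hW.linked.next k hk₀ hk
    have hout := T.outBelow_lt hk₀ hnext.le
    have hnb : T.d (T.dst k) * ((τ.arr .up (T.src k) + T.wt k) / T.d (T.dst k)) =
      T.newBound (τ.arr .up) k := rfl
    have hj₀ := hT.dst_nonneg k hk₀ hk
    have hj := hT.dst_lt k hk₀ hk
    -- what is known of a constraint: the pending ones are `k` and those still in the list
    have htight : ∀ e : ℤ, 0 ≤ e → e < T.m → (T.Tight (τ.arr .up) e ∨ e = k) ∨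
        τ.arr .inDirty (T.src e) ≠ 0 ∨ (T.src e = T.src k ∧ e < τ.arr .next k) := by
      intro e he₀ he
      rcases hW.tight hsat e he₀ he with h | h | ⟨h₁, h₂⟩
      · exact Or.inl (Or.inl h)
      · exact Or.inr (Or.inl h)
      · rcases eq_or_ne e k with rfl | hne
        · exact Or.inl (Or.inr rfl)
        · refine Or.inr (Or.inr ⟨h₁, ?_⟩)
          by_contra hge
          exact hnext.none_above e (not_lt.1 hge) (by omega) h₁
    have hnl := hnext.le
    simp only [Ends.seq_iff, Ends.ite_iff, Ends.set_iff, Ends.store_iff, Ends.skip_iff]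
    by_cases hlt : T.newBound (τ.arr .up) k < τ.arr .up (T.dst k)
    · have hsl := slack_update (fun i => 120 * T.outBelow i T.m) hj₀ hj hlt
        (hτ.lo_le_up hsat hj₀ hj)
      by_cases hlo : T.newBound (τ.arr .up) k < τ.arr .lo (T.dst k)
      · simp [Cond.Holds, Cond.cost, hke, hL.src, hL.dst, hL.wt, hL.d, newBound, roundDown, hnb,
          hlt, hlo, Table.credit]
        refine ⟨⟨⟨?_, ⟨?_, ?_⟩, ?_, ?_, ?_, ?_⟩, ?_, ?_, ?_⟩, by omega⟩
        · refine hτ.update hT hsat (e := k) ?_ hk₀ hk hlt ?_ ?_ ?_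
          · constructor <;> simp [hL.n, hL.m, hL.src, hL.dst, hL.wt, hL.d]
          · simp
          · simp
          · simp [hlo]
        · simpa using hW.linked.head
        · simpa using hW.linked.next
        · simpa using hW.top_nonneg
        · simpa using hW.pool
        · simpa using hW.mem_pool
        · simp
        · simpa using hnext.nonneg
        · simp; omega
        · simpa using hnext.src_eq
      · by_cases hd : τ.arr .inDirty (T.dst k) = 0
        · simp [Cond.Holds, Cond.cost, hke, hL.src, hL.dst, hL.wt, hL.d, newBound, roundDown, hnb,
            hlt, hlo, hd, Table.credit]
          rw [poolSum_succ _ _ hW.top_nonneg, poolSum_update_of_le _ _ le_rfl,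
            Function.update_self]
          refine ⟨⟨⟨?_, ⟨?_, ?_⟩, ?_, ?_, ?_, ?_⟩, ?_, ?_, ?_⟩, by omega⟩
          · refine hτ.update hT hsat (e := k) ?_ hk₀ hk hlt ?_ ?_ ?_
            · constructor <;> simp [hL.n, hL.m, hL.src, hL.dst, hL.wt, hL.d]
            · simp
            · simp
            · simp [hlo, hsat]
          · simpa using hW.linked.head
          · simpa using hW.linked.next
          · have := hW.top_nonneg
            simp
            omega
          · simp
            intro l hl₀ hl
            rcases eq_or_ne l (τ.reg .top) with rfl | hne
            · simp [hj₀, hj]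
            · simpa [hne] using hW.pool l hl₀ (by omega)
          · simp
            intro v hv₀ hv hvd
            rcases eq_or_ne v (T.dst k) with rfl | hne
            · exact ⟨τ.reg .top, hW.top_nonneg, le_rfl, by simp⟩
            · obtain ⟨l, hl₀, hl, hlv⟩ := hW.mem_pool v hv₀ hv (by simpa [hne] using hvd)
              exact ⟨l, hl₀, hl.le, by rwa [Function.update_of_ne hl.ne]⟩
          · simp
            intro _ e he₀ he
            rcases eq_or_ne (T.src e) (T.dst k) with hs | hs
            · exact Or.inr (Or.inl (by simp [hs]))
            · rcases htight e he₀ he with h | h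
              · exact Or.inl (T.tight_update h hs hlt)
              · exact Or.inr (by simpa [hs] using h)
          · simpa using hnext.nonneg
          · simp; omega
          · simpa using hnext.src_eq
        · simp [Cond.Holds, Cond.cost, hke, hL.src, hL.dst, hL.wt, hL.d, newBound, roundDown, hnb,
            hlt, hlo, hd, Table.credit]
          refine ⟨⟨⟨?_, ⟨?_, ?_⟩, ?_, ?_, ?_, ?_⟩, ?_, ?_, ?_⟩, by omega⟩
          · refine hτ.update hT hsat (e := k) ?_ hk₀ hk hlt ?_ ?_ ?_
            · constructor <;> simp [hL.n, hL.m, hL.src, hL.dst, hL.wt, hL.d]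
            · simp
            · simp
            · simp [hlo, hsat]
          · simpa using hW.linked.head
          · simpa using hW.linked.next
          · simpa using hW.top_nonneg
          · simpa using hW.pool
          · simpa using hW.mem_pool
          · simp
            intro _ e he₀ he
            rcases eq_or_ne (T.src e) (T.dst k) with hs | hs
            · exact Or.inr (Or.inl (by simpa [hs] using hd))
            · rcases htight e he₀ he with h | h
              · exact Or.inl (T.tight_update h hs hlt)
              · exact Or.inr h
          · simpa using hnext.nonneg
          · simp; omega
          · simpa using hnext.src_eq
    · simp [Cond.Holds, Cond.cost, hke, hL.src, hL.dst, hL.wt, hL.d, newBound, roundDown, hnb,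
        hlt, Table.credit]
      refine ⟨⟨⟨?_, ⟨?_, ?_⟩, ?_, ?_, ?_, ?_⟩, ?_, ?_, ?_⟩, by omega⟩
      · refine hτ.congr ?_ ?_ ?_ ?_
        · constructor <;> simp [hL.n, hL.m, hL.src, hL.dst, hL.wt, hL.d]
        all_goals simp
      · simpa using hW.linked.head
      · simpa using hW.linked.next
      · simpa using hW.top_nonneg
      · simpa using hW.pool
      · simpa using hW.mem_pool
      · simp
        intro _ e he₀ he
        rcases htight e he₀ he with (h | rfl) | h
        · exact Or.inl h
        · exact Or.inl (not_lt.1 hlt)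
        · exact Or.inr h
      · simpa using hnext.nonneg
      · simp; omega
      · simpa using hnext.src_eq
  · rintro t τ - ⟨⟨hW, hc₀, hcm, hci⟩, hcond, ht⟩
    simp [Cond.Holds] at hcond
    simp [Cond.cost] at ht
    have := T.outBelow_mono i hσ.le
    refine ⟨{ hW with tight := fun hs e he₀ he => ?_ }, by omega⟩
    rcases hW.tight hs e he₀ he with h | h | h
    · exact Or.inl h
    · exact Or.inr (Or.inl h)
    · have : τ.reg .e = 0 := by
        by_contra hne
        exact hcond hne hs
      omega

theorem worklist_ends {T : Table} (hT : T.Valid) {p : ℤ → ℤ} (hp : T.Feasible p) {σ : Store}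
    (hσ : T.Boxed p σ) :
    Ends worklist σ fun t τ =>
      t ≤ T.m * (2 * (T.n * T.lcmDiv) + 1) * 120 + T.n * 100 + T.m * 150 + 50 ∧
        T.Answer p τ := by
  unfold worklist
  refine Ends.seq (buildAdjacency_ends hT hσ.loaded) ?_
  rintro t₁ σ₁ hF₁ ⟨ht₁, hlink₁⟩
  have hσ₁ : T.Propagating p σ₁ := hσ.propagating.congr (hσ.loaded.of_frame hF₁ rfl)
    (hF₁.arr .lo rfl) (hF₁.arr .up rfl) (hF₁.reg .sat rfl)
  -- at first, all variables are dirty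
  refine Ends.seq (Ends.forBelow 6 (fun k τ => ∀ i : ℤ, 0 ≤ i → i < k →
    τ.arr .pool i = i ∧ τ.arr .inDirty i = 1) hσ₁.loaded.n
    (by decide) rfl rfl (fun i h₀ h => absurd h₀ (by omega)) ?_) ?_
  · intro k τ hk₀ hk hF hki hI
    simp [hki]
    intro i hi₀ hi
    rcases eq_or_ne i k with rfl | hne
    · simp
    · simpa [hne] using hI i hi₀ (by omega)
  rintro t₂ σ₂ hF₂ ⟨ht₂, hI₂⟩
  have hσ₂ : T.Propagating p σ₂ := hσ₁.congr (hσ₁.loaded.of_frame hF₂ rfl)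
    (hF₂.arr .lo rfl) (hF₂.arr .up rfl) (hF₂.reg .sat rfl)
  have hlink₂ : T.Linked σ₂ := by
    constructor
    · rw [hF₂.arr .head rfl]; exact hlink₁.head
    · rw [hF₂.arr .next rfl]; exact hlink₁.next
  have hL := hσ₂.loaded
  simp only [Ends.seq_iff (s := .set .top _), Ends.set_iff, eval_reg, hL.n, cost_reg]
  have hslack := hσ₂.slack_le fun i => 120 * T.outBelow i T.m
  have hpool : poolSum (fun i => 40 + 120 * T.outBelow i T.m) (σ₂.arr .pool) T.n ≤
      40 * T.n + 120 * T.m := by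
    have h : poolSum (fun i => 40 + 120 * T.outBelow i T.m) (σ₂.arr .pool) T.n =
        ∑ i ∈ Finset.Ico (0 : ℤ) T.n, (40 + 120 * T.outBelow i T.m) :=
      Finset.sum_congr rfl fun i hi => by
        rw [Finset.mem_Ico] at hi
        rw [(hI₂ i hi.1 hi.2).1]
    rw [h, Finset.sum_add_distrib, ← Finset.mul_sum]
    have := T.sum_outBelow_le
    simp
    omega
  refine (Ends.loop (T.Working p fun _ => False) T.credit
    ⟨?_, ⟨?_, ?_⟩, ?_, ?_, ?_, ?_⟩ ?_).mono ?_
  · refine hσ₂.congr ?_ ?_ ?_ ?_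
    · constructor <;> simp [hL.n, hL.m, hL.src, hL.dst, hL.wt, hL.d]
    all_goals simp
  · simpa using hlink₂.head
  · simpa using hlink₂.next
  · simp
  · simp
    intro k hk₀ hk
    rw [(hI₂ k hk₀ hk).1]
    exact ⟨hk₀, hk⟩
  · simp
    exact fun i hi₀ hi _ => ⟨i, hi₀, hi, (hI₂ i hi₀ hi).1⟩
  · simp
    intro _ e he₀ he
    rw [(hI₂ _ (hT.src_nonneg e he₀ he) (hT.src_lt e he₀ he)).2]
    exact Or.inr one_ne_zero
  · rintro τ - hcond hW
    have hτ := hW.propagating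
    have hL := hτ.loaded
    simp [Cond.Holds] at hcond
    obtain ⟨htop, hsat⟩ := hcond
    simp only [Ends.seq_iff (s := .set _ _), Ends.seq_iff (s := .store _ _ _),
      Ends.seq_iff (s := .pick _ _), Ends.set_iff, Ends.store_iff, Ends.pick_iff]
    simp
    -- the chosen entry of the pool
    obtain ⟨k, hkc⟩ : ∃ k, (τ.choices 0 : ℤ) % τ.reg .top = k := ⟨_, rfl⟩
    have hk₀ : 0 ≤ k := hkc ▸ Int.emod_nonneg _ htop.ne'
    have hk : k < τ.reg .top := hkc ▸ Int.emod_lt_of_pos _ htop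
    obtain ⟨hi₀, hi⟩ := hW.pool k hk₀ hk
    have hlast := hW.linked.head _ hi₀ hi
    have hrem := poolSum_remove (fun i => 40 + 120 * T.outBelow i T.m) (τ.arr .pool) hk₀ hk
    rw [hkc]
    refine (scan_ends hT (p := p) (i := τ.arr .pool k)
      ⟨⟨?_, ⟨?_, ?_⟩, ?_, ?_, ?_, ?_⟩, ?_, ?_, ?_⟩).mono ?_
    · refine hτ.congr ?_ ?_ ?_ ?_
      · constructor <;> simp [hL.n, hL.m, hL.src, hL.dst, hL.wt, hL.d]
      all_goals simp
    · simpa using hW.linked.head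
    · simpa using hW.linked.next
    · simp
      omega
    · simp
      intro l hl₀ hl
      rcases eq_or_ne l k with rfl | hne
      · simpa using hW.pool (τ.reg .top - 1) (by omega) (by omega)
      · simpa [hne] using hW.pool l hl₀ (by omega)
    · simp
      intro v hv₀ hv hvd
      rcases eq_or_ne v (τ.arr .pool k) with rfl | hne
      · simp at hvd
      · obtain ⟨l, hl₀, hl, hlv⟩ := hW.mem_pool v hv₀ hv (by simpa [hne] using hvd)
        have hlk : l ≠ k := by
          rintro rfl
          exact hne hlv.symm
        -- if `v` was the last entry, it is now in the place of the removed one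
        rcases eq_or_ne l (τ.reg .top - 1) with rfl | hlt
        · exact ⟨k, hk₀, by omega, by simpa using hlv⟩
        · exact ⟨l, hl₀, by omega, by rwa [Function.update_of_ne hlk]⟩
    · simp
      intro hs e he₀ he
      rcases eq_or_ne (T.src e) (τ.arr .pool k) with hs' | hs'
      · refine Or.inr (Or.inr ⟨hs', ?_⟩)
        by_contra hge
        exact hlast.none_above e (not_lt.1 hge) he hs'
      · rcases hW.tight hs e he₀ he with h | h | h
        · exact Or.inl h
        · exact Or.inr (Or.inl (by simpa [hs'] using h))
        · exact h.elim
    · simpa using hlast.nonneg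
    · simpa using hlast.le
    · simpa using hlast.src_eq
    · rintro t υ - ⟨hυ, ht⟩
      simp [Table.credit] at ht
      refine ⟨hυ, ?_⟩
      simp [Cond.cost, Table.credit]
      omega
  · rintro t τ - ⟨hW, hcond, ht⟩
    simp [Cond.Holds] at hcond
    simp [Cond.cost, Table.credit] at ht
    refine ⟨?_, hW.propagating.answer hT hp fun hs e he₀ he => ?_⟩
    · rw [← Finset.mul_sum] at hslack
      have h₁ := Nat.mul_le_mul_right (2 * (T.n * T.lcmDiv) + 1)
        (Nat.mul_le_mul_left 120 T.sum_outBelow_le)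
      have h₂ : 120 * T.m * (2 * (T.n * T.lcmDiv) + 1) =
        T.m * (2 * (T.n * T.lcmDiv) + 1) * 120 := by ring
      omega
    · rcases hW.tight hs e he₀ he with h | h | h
      · exact h
      · obtain ⟨k, hk₀, hk, -⟩ := hW.mem_pool _ (hT.src_nonneg e he₀ he) (hT.src_lt e he₀ he) h
        exact absurd hs (hcond (by omega))
      · exact h.elim

/-! ### The algorithm for simple systems -/

/-- The program `propagate` finishes the algorithm from any box in at most `cost n m D` steps. -/
def Propagates (propagate : Stmt) (cost : ℕ → ℕ → ℕ → ℕ) : Prop :=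
  ∀ T : Table, T.Valid → ∀ p : ℤ → ℤ, T.Feasible p → ∀ σ : Store, T.Boxed p σ →
    Ends propagate σ fun t τ => t ≤ cost T.n T.m T.lcmDiv ∧ T.Answer p τ

/-- A bound on the number of steps of `sweep`. -/
def sweepCost (n m D : ℕ) : ℕ := (n * (2 * (n * D) + 1) + 1) * (m * 50 + 30) + 10

/-- A bound on the number of steps of `worklist`. -/
def worklistCost (n m D : ℕ) : ℕ := m * (2 * (n * D) + 1) * 120 + n * 100 + m * 150 + 50

theorem sweep_propagates : Propagates sweep sweepCost :=
  fun _ hT _ hp _ hσ => sweep_ends hT hp hσ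

theorem worklist_propagates : Propagates worklist worklistCost :=
  fun _ hT _ hp _ hσ => worklist_ends hT hp hσ

/-- A bound on the number of steps that are not spent in the propagation. -/
def overhead (n m D : ℕ) : ℕ :=
  n * (m * 25 + 25) + m * 25 + n * (D * 12 + 100) + 100

theorem solveFrom_ends {propagate : Stmt} {cost : ℕ → ℕ → ℕ → ℕ} (hc : Propagates propagate cost)
    {T : Table} (hT : T.Valid) {σ : Store} (hσ : T.Loaded σ) (hp : T.Feasible (σ.arr .p)) :
    Ends (solveFrom propagate) σ fun t τ =>
      t ≤ T.n * (T.lcmDiv * 12 + 100) + 30 + cost T.n T.m T.lcmDiv ∧ T.Answer (σ.arr .p) τ := by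
  refine Ends.seq (box_ends hT hσ) ?_
  rintro t₁ σ₁ - ⟨ht₁, hb⟩
  refine (hc T hT _ hp _ hb).mono ?_
  rintro t₂ σ₂ - ⟨ht₂, ha⟩
  exact ⟨by omega, ha⟩

theorem solve_ends {propagate : Stmt} {cost : ℕ → ℕ → ℕ → ℕ} (hc : Propagates propagate cost)
    {T : Table} (hT : T.Valid) {σ : Store} (hσ : T.Loaded σ) :
    Ends (solve propagate) σ fun t τ =>
      t ≤ overhead T.n T.m T.lcmDiv + cost T.n T.m T.lcmDiv ∧
      ((τ.reg .sat = 1 ∧ T.Solves (τ.arr .up)) ∨ (τ.reg .sat = 0 ∧ ¬ ∃ x, T.Solves x)) := by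
  refine Ends.seq (findIntegral_ends hT hσ) ?_
  rintro t₁ σ₁ hF₁ ⟨ht₁, h⟩
  have hσ₁ := hσ.of_frame hF₁ rfl
  unfold overhead
  refine Ends.ite (fun hs => ?_) (fun hs => ?_)
  · simp [Cond.Holds] at hs
    refine (solveFrom_ends hc hT hσ₁ (h.resolve_right fun h => by omega).2).mono ?_
    rintro t₂ σ₂ - ⟨ht₂, ha⟩
    simp [Cond.cost]
    refine ⟨by omega, ?_⟩
    rcases ha with h | h
    · exact Or.inl ⟨h.1, h.2.1⟩
    · exact Or.inr ⟨h.1, by simpa using h.2⟩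
  · simp [Cond.Holds] at hs
    obtain ⟨h₁, h₂⟩ := h.resolve_left fun h => hs h.1
    simp [Cond.cost]
    refine ⟨by omega, Or.inr ⟨h₁, fun x hx => h₂ ⟨x, hx.1⟩⟩⟩

theorem overhead_le {n m D : ℕ} (hn : 1 ≤ n) (hm : 1 ≤ m) (hD : 1 ≤ D) :
    overhead n m D ≤ 300 * (n * m * D) := by
  have h₁ : n * m ≤ n * m * D := Nat.le_mul_of_pos_right _ hD
  have h₂ : n ≤ n * m := Nat.le_mul_of_pos_right _ hm
  have h₃ : m ≤ n * m := Nat.le_mul_of_pos_left _ hn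
  have h₄ : n * D ≤ n * m * D := Nat.mul_le_mul_right _ h₂
  unfold overhead
  nlinarith

theorem worklistCost_le {n m D : ℕ} (hn : 1 ≤ n) (hm : 1 ≤ m) (hD : 1 ≤ D) :
    worklistCost n m D ≤ 700 * (n * m * D) := by
  have h₁ : n * m ≤ n * m * D := Nat.le_mul_of_pos_right _ hD
  have h₂ : n ≤ n * m := Nat.le_mul_of_pos_right _ hm
  have h₃ : m ≤ n * m := Nat.le_mul_of_pos_left _ hn
  have h₄ : m * (2 * (n * D) + 1) = 2 * (n * m * D) + m := by ring
  unfold worklistCost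
  rw [h₄]
  omega

theorem sweepCost_le {n m D : ℕ} (hn : 1 ≤ n) (hm : 1 ≤ m) (hD : 1 ≤ D) :
    sweepCost n m D ≤ 400 * (n ^ 2 * m * D) := by
  have h₁ : n * (2 * (n * D) + 1) + 1 ≤ 4 * (n ^ 2 * D) := by
    have h₂ : n ≤ n * (n * D) := Nat.le_mul_of_pos_right _ (by positivity)
    have h₃ : n ^ 2 * D = n * (n * D) := by ring
    rw [h₃]
    nlinarith
  have h₂ : m * 50 + 30 ≤ m * 80 := by omega
  have h₃ : 4 * (n ^ 2 * D) * (m * 80) = 320 * (n ^ 2 * m * D) := by ring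
  have h₄ := Nat.mul_le_mul h₁ h₂
  have h₅ : 1 ≤ n ^ 2 * m * D := Nat.one_le_iff_ne_zero.2 (by positivity)
  unfold sweepCost
  omega

/-! ### The reduction of general systems to simple ones -/

namespace Table

/-- `T` with one more constraint `x j ≤ x i + c`. -/
def push (T : Table) (i j c : ℤ) : Table :=
  { T with
    m := T.m + 1
    src := Function.update T.src T.m i
    dst := Function.update T.dst T.m j
    wt := Function.update T.wt T.m c }

theorem push_feasible {T : Table} {i j c : ℤ} {x : ℤ → ℤ} :
    (T.push i j c).Feasible x ↔ T.Feasible x ∧ x j ≤ x i + c := by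
  constructor
  · intro h
    refine ⟨fun e h₀ he => ?_, by simpa [push] using h T.m (by positivity) (by simp [push])⟩
    have := h e h₀ (by simp only [push]; push_cast; omega)
    have hne : e ≠ T.m := he.ne
    simpa [push, hne] using this
  · rintro ⟨h, h'⟩ e h₀ he
    simp only [push] at he ⊢
    rcases eq_or_ne e T.m with rfl | hne
    · simpa using h'
    · simpa [hne] using h e h₀ (by push_cast at he; omega)

/-- The constraints mention only variables below `N`. -/
def InRange (T : Table) (N : ℤ) : Prop :=
  ∀ e : ℤ, 0 ≤ e → e < T.m → (0 ≤ T.src e ∧ T.src e < N) ∧ (0 ≤ T.dst e ∧ T.dst e < N)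

theorem InRange.push {T : Table} {N i j : ℤ} (h : T.InRange N) (hi₀ : 0 ≤ i) (hi : i < N)
    (hj₀ : 0 ≤ j) (hj : j < N) (c : ℤ) : (T.push i j c).InRange N := by
  intro e h₀ he
  simp only [Table.push] at he ⊢
  rcases eq_or_ne e T.m with rfl | hne
  · simp [hi₀, hi, hj₀, hj]
  · simpa [hne] using h e h₀ (by push_cast at he; omega)

end Table

/-- A general SDBM as it is laid out in memory. -/
structure BoundedTable extends Table where
  r : ℤ → ℤ
  hasLo : ℤ → ℤ
  loBd : ℤ → ℤ
  hasHi : ℤ → ℤ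
  hiBd : ℤ → ℤ

namespace BoundedTable

/-- The memory holds the table `G`, its remainders and its variable bounds. -/
structure Loaded (G : BoundedTable) (σ : Store) : Prop extends G.toTable.Loaded σ where
  r : σ.arr .r = G.r
  hasLo : σ.arr .hasLo = G.hasLo
  loBd : σ.arr .loBd = G.loBd
  hasHi : σ.arr .hasHi = G.hasHi
  hiBd : σ.arr .hiBd = G.hiBd

/-- `z` satisfies the bounds of variable `i`. -/
def WithinBounds (G : BoundedTable) (i z : ℤ) : Prop :=
  (G.hasLo i = 1 → G.loBd i ≤ z) ∧ (G.hasHi i = 1 → z ≤ G.hiBd i)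

/-- `x` satisfies the difference bounds, the variable bounds, and the congruences. -/
def Solves (G : BoundedTable) (x : ℤ → ℤ) : Prop :=
  G.Feasible x ∧ ∀ i : ℤ, 0 ≤ i → i < G.n → G.WithinBounds i (x i) ∧ G.d i ∣ x i - G.r i

/-- The number of variable bounds on variables below `k`. -/
noncomputable def numBounds (G : BoundedTable) (k : ℤ) : ℕ :=
  ∑ i ∈ Finset.Ico 0 k, ((if G.hasLo i = 1 then 1 else 0) + if G.hasHi i = 1 then 1 else 0)

theorem numBounds_succ (G : BoundedTable) {k : ℤ} (hk : 0 ≤ k) :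
    G.numBounds (k + 1) = G.numBounds k +
      ((if G.hasLo k = 1 then 1 else 0) + if G.hasHi k = 1 then 1 else 0) := by
  have : Finset.Ico 0 (k + 1) = insert k (Finset.Ico 0 k) := by
    ext; simp only [Finset.mem_insert, Finset.mem_Ico]; omega
  rw [numBounds, this, Finset.sum_insert (by simp), numBounds, add_comm]

/-- The values of the original variables that belong to values `y` of the shifted variables and of the
new variable, whose number is `G.n`. -/
def restore (G : BoundedTable) (y : ℤ → ℤ) (i : ℤ) : ℤ := y i - y G.n + G.r i

/-- `U` has the difference bounds of `G` and the bounds on the variables of `G` below `k`, all of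
them for the shifted variables and the new variable. -/
structure Translated (G : BoundedTable) (k : ℤ) (U : Table) : Prop where
  m : U.m = G.m + G.numBounds k
  inRange : U.InRange (G.n + 1)
  feasible : ∀ y, U.Feasible y ↔ G.Feasible (G.restore y) ∧
    ∀ i : ℤ, 0 ≤ i → i < k → G.WithinBounds i (G.restore y i)

theorem Translated.step {G : BoundedTable} {k : ℤ} {U : Table} (h : G.Translated k U)
    (hk₀ : 0 ≤ k) (hk : k < G.n) {V W : Table}
    (hV : V = if G.hasLo k = 1 then U.push k G.n (G.r k - G.loBd k) else U)
    (hW : W = if G.hasHi k = 1 then V.push G.n k (G.hiBd k - G.r k) else V) :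
    G.Translated (k + 1) W := by
  have hV₁ : V.m = U.m + if G.hasLo k = 1 then 1 else 0 := by
    rw [hV]; split_ifs <;> rfl
  have hV₂ : V.InRange (G.n + 1) := by
    rw [hV]; split_ifs
    · exact h.inRange.push hk₀ (by omega) (by omega) (by omega) _
    · exact h.inRange
  have hV₃ : ∀ y, V.Feasible y ↔ U.Feasible y ∧ (G.hasLo k = 1 → G.loBd k ≤ G.restore y k) := by
    intro y
    rw [hV]; split_ifs with hc
    · have : y G.n ≤ y k + (G.r k - G.loBd k) ↔ G.loBd k ≤ G.restore y k := by
        unfold restore; omega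
      simp [Table.push_feasible, hc, this]
    · simp [hc]
  refine ⟨?_, ?_, fun y => ?_⟩
  · rw [G.numBounds_succ hk₀, ← add_assoc, ← add_assoc, ← h.m, ← hV₁, hW]
    split_ifs <;> rfl
  · rw [hW]; split_ifs
    · exact hV₂.push (by omega) (by omega) hk₀ (by omega) _
    · exact hV₂
  · have hW₃ : W.Feasible y ↔ V.Feasible y ∧ (G.hasHi k = 1 → G.restore y k ≤ G.hiBd k) := by
      rw [hW]; split_ifs with hc
      · have : y k ≤ y G.n + (G.hiBd k - G.r k) ↔ G.restore y k ≤ G.hiBd k := by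
          unfold restore; omega
        simp [Table.push_feasible, hc, this]
      · simp [hc]
    rw [hW₃, hV₃, h.feasible]
    constructor
    · rintro ⟨⟨⟨h₁, h₂⟩, h₃⟩, h₄⟩
      refine ⟨h₁, fun i hi₀ hi => ?_⟩
      rcases eq_or_ne i k with rfl | hne
      · exact ⟨h₃, h₄⟩
      · exact h₂ i hi₀ (by omega)
    · rintro ⟨h₁, h₂⟩
      have h₃ := h₂ k hk₀ (by omega)
      exact ⟨⟨⟨h₁, fun i hi₀ hi => h₂ i hi₀ (by omega)⟩, h₃.1⟩, h₃.2⟩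

end BoundedTable

/-- The memory holds the constraints of `U`. -/
structure Table.Stored (U : Table) (σ : Store) : Prop where
  m : σ.reg .m = U.m
  src : σ.arr .src = U.src
  dst : σ.arr .dst = U.dst
  wt : σ.arr .wt = U.wt

/-- A step of the reduction, which appends a constraint under a condition. -/
theorem append_ends {U : Table} {σ : Store} (hσ : U.Stored σ) {x y : Reg} {e : Expr} {A : Arr}
    {i j c k : ℤ} (hx : σ.reg x = i) (hy : σ.reg y = j) (hk : σ.reg .i = k) (hec : e.cost = 5)
    (he : ∀ s d, e.eval ((σ.setArr .src U.m s).setArr .dst U.m d) = c) :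
    Ends (ite (.eq (get A Reg.i) 1)
      (store .src Reg.m x ;; store .dst Reg.m y ;; store .wt Reg.m e ;;
       .m ::= (Reg.m : Expr) + 1) skip) σ fun t τ =>
      t ≤ 22 ∧ (if σ.arr A k = 1 then U.push i j c else U).Stored τ := by
  rw [Ends.ite_iff]
  simp [Cond.Holds, Cond.cost, hk, hσ.m, hx, hy, hec, he]
  refine ⟨fun hA => ?_, fun hA => ?_⟩
  · rw [if_pos hA]
    constructor <;> simp [Table.push, hσ.src, hσ.dst, hσ.wt]
  · rwa [if_neg hA]

/-- The reduction to a simple system, whose solutions are those of the given system up to a shift of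
the variables. -/
structure BoundedTable.Reduces (G : BoundedTable) (T : Table) : Prop where
  valid : T.Valid
  n : T.n = G.n + 1
  m : T.m = G.m + G.numBounds G.n
  lcmDiv : T.lcmDiv = G.lcmDiv
  restore : ∀ y, T.Solves y → G.Solves (G.restore y)
  satisfiable : (∃ x, G.Solves x) → ∃ y, T.Solves y

/-- Giving the new variable the value `0` turns a solution of `G` into one of `T`. Conversely, the
new variable is a multiple of all strides, so subtracting it keeps the congruences. -/
theorem BoundedTable.Translated.reduces {G : BoundedTable} (hG : G.Valid) {U T : Table}
    (hU : G.Translated G.n U) (hn : T.n = G.n + 1) (hm : T.m = U.m) (hsrc : T.src = U.src)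
    (hdst : T.dst = U.dst) (hwt : T.wt = U.wt)
    (hd : T.d = Function.update G.d G.n G.lcmDiv) : G.Reduces T := by
  have hfeas : ∀ y, T.Feasible y ↔ U.Feasible y := fun y => by
    simp [Table.Feasible, hm, hsrc, hdst, hwt]
  have hdi : ∀ i : ℤ, i < G.n → T.d i = G.d i := fun i hi => by
    rw [hd, Function.update_of_ne hi.ne]
  have hdn : T.d G.n = G.lcmDiv := by rw [hd, Function.update_self]
  have hD := hG.lcmDiv_pos
  have hr : ∀ e : ℤ, 0 ≤ e → e < T.m →
      (0 ≤ T.src e ∧ T.src e < T.n) ∧ (0 ≤ T.dst e ∧ T.dst e < T.n) := by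
    rw [hm, hsrc, hdst, hn]
    exact_mod_cast hU.inRange
  refine ⟨⟨fun e h₀ he => (hr e h₀ he).1.1, fun e h₀ he => (hr e h₀ he).1.2,
    fun e h₀ he => (hr e h₀ he).2.1, fun e h₀ he => (hr e h₀ he).2.2, fun i h₀ hi => ?_⟩,
    hn, hm.trans hU.m, ?_, fun y hy => ?_, ?_⟩
  · rcases eq_or_ne i G.n with rfl | hne
    · rw [hdn]
      omega
    · rw [hdi i (by omega)]
      exact hG.d_ne_zero i h₀ (by omega)
  · have h : T.lcmBelow G.n = G.lcmDiv := Finset.lcm_congr rfl fun i hi => by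
      rw [hdi i (Finset.mem_Ico.1 hi).2]
    rw [Table.lcmDiv, hn]
    push_cast
    rw [T.lcmBelow_succ (by positivity), h, hdn, Int.natAbs_natCast, Nat.lcm_self]
  · obtain ⟨h₁, h₂⟩ := (hU.feasible y).1 ((hfeas y).1 hy.1)
    refine ⟨h₁, fun i hi₀ hi => ⟨h₂ i hi₀ hi, ?_⟩⟩
    have h₃ : G.d i ∣ y i := hdi i hi ▸ hy.2 i hi₀ (by omega)
    have h₄ : (G.lcmDiv : ℤ) ∣ y G.n := hdn ▸ hy.2 G.n (by positivity) (by omega)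
    have h₅ : G.restore y i - G.r i = y i - y G.n := by unfold BoundedTable.restore; ring
    rw [h₅]
    exact dvd_sub h₃ ((G.dvd_lcmDiv hi₀ hi).trans h₄)
  · rintro ⟨x, hx₁, hx₂⟩
    have hres : ∀ i : ℤ, i < G.n →
        G.restore (fun i => if i = G.n then 0 else x i - G.r i) i = x i := fun i hi => by
      simp [BoundedTable.restore, hi.ne]
    refine ⟨fun i => if i = G.n then 0 else x i - G.r i,
      (hfeas _).2 ((hU.feasible _).2 ⟨fun e h₀ he => ?_, fun i hi₀ hi => ?_⟩),
      fun i hi₀ hi => ?_⟩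
    · rw [hres _ (hG.src_lt e h₀ he), hres _ (hG.dst_lt e h₀ he)]
      exact hx₁ e h₀ he
    · rw [hres i hi]
      exact (hx₂ i hi₀ hi).1
    · rcases eq_or_ne i G.n with rfl | hne
      · simp
      · simp only [if_neg hne]
        rw [hdi i (by omega)]
        exact (hx₂ i hi₀ (by omega)).2

theorem makeSimple_ends {G : BoundedTable} (hG : G.Valid) {σ : Store} (hσ : G.Loaded σ) :
    Ends makeSimple σ fun t τ =>
      t ≤ G.n * (G.lcmDiv * 12 + 100) + G.m * 30 + 50 ∧ ∃ T : Table, T.Loaded τ ∧ G.Reduces T := by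
  unfold makeSimple
  refine Ends.seq (computeLcm_ends hG hσ.n fun i _ _ => by rw [hσ.d]) ?_
  rintro t₁ σ₁ hF₁ ⟨ht₁, hl₁⟩
  have hσ₁ := hσ.toLoaded.of_frame hF₁ rfl
  have hr₁ : σ₁.arr .r = G.r := (hF₁.arr .r rfl).trans hσ.r
  refine Ends.seq (Ends.forBelow 13 (fun k τ => ∀ e : ℤ, 0 ≤ e → τ.arr .wt e =
    if e < k then G.wt e + (G.r (G.src e) - G.r (G.dst e)) else G.wt e) hσ₁.m
    (by decide) rfl rfl (fun e h₀ => ?_) ?_) ?_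
  · simp [hσ₁.wt, h₀]
  · intro k τ hk₀ hk hF hke hI
    have hsrc : τ.arr .src = G.src := (hF.arr .src rfl).trans hσ₁.src
    have hdst : τ.arr .dst = G.dst := (hF.arr .dst rfl).trans hσ₁.dst
    have hr : τ.arr .r = G.r := (hF.arr .r rfl).trans hr₁
    simp [hke, hsrc, hdst, hr]
    intro e he₀
    rcases eq_or_ne e k with rfl | hne
    · simp [hI e he₀]
    · have : e ≤ k ↔ e < k := by omega
      simp [hne, hI e he₀, this]
  rintro t₂ σ₂ hF₂ ⟨ht₂, hwt₂⟩
  have hn₂ : σ₂.reg .n = G.n := (hF₂.reg .n rfl).trans hσ₁.n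
  have hr₂ : σ₂.arr .r = G.r := (hF₂.arr .r rfl).trans hr₁
  have hlo₂ : σ₂.arr .hasLo = G.hasLo :=
    (hF₂.arr .hasLo rfl).trans ((hF₁.arr .hasLo rfl).trans hσ.hasLo)
  have hlob₂ : σ₂.arr .loBd = G.loBd :=
    (hF₂.arr .loBd rfl).trans ((hF₁.arr .loBd rfl).trans hσ.loBd)
  have hhi₂ : σ₂.arr .hasHi = G.hasHi :=
    (hF₂.arr .hasHi rfl).trans ((hF₁.arr .hasHi rfl).trans hσ.hasHi)
  have hhib₂ : σ₂.arr .hiBd = G.hiBd :=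
    (hF₂.arr .hiBd rfl).trans ((hF₁.arr .hiBd rfl).trans hσ.hiBd)
  refine Ends.seq (Ends.forBelow 44 (fun k τ => ∃ U : Table, U.Stored τ ∧ G.Translated k U) hn₂
    (by decide) rfl rfl ?_ ?_) ?_
  · refine ⟨⟨G.n, G.m, G.src, G.dst, σ₂.arr .wt, G.d⟩, ⟨?_, ?_, ?_, ?_⟩, ?_, ?_, fun y => ?_⟩
    · simpa using (hF₂.reg .m rfl).trans hσ₁.m
    · exact (hF₂.arr .src rfl).trans hσ₁.src
    · exact (hF₂.arr .dst rfl).trans hσ₁.dst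
    · rfl
    · simp [BoundedTable.numBounds]
    · intro e h₀ he
      have h₁ := hG.src_nonneg e h₀ he
      have h₂ := hG.src_lt e h₀ he
      have h₃ := hG.dst_nonneg e h₀ he
      have h₄ := hG.dst_lt e h₀ he
      exact ⟨⟨h₁, by simp only; omega⟩, h₃, by simp only; omega⟩
    · refine Iff.trans ?_ (and_iff_left fun i h₀ h => absurd h₀ (by omega)).symm
      refine forall₃_congr fun e h₀ he => ?_
      have hwe := hwt₂ e h₀
      rw [if_pos he] at hwe
      simp only [BoundedTable.restore, hwe]
      omega
  · rintro k τ hk₀ hk hF hki ⟨U, hU, hG'⟩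
    have hn : τ.reg .n = G.n := (hF.reg .n rfl).trans hn₂
    have hr : τ.arr .r = G.r := (hF.arr .r rfl).trans hr₂
    refine Ends.seq (append_ends (i := k) (j := G.n) (c := G.r k - G.loBd k) (k := k) hU hki hn
      hki rfl ?_) ?_
    · simp [hki, hr, (hF.arr .loBd rfl).trans hlob₂]
    rintro t₃ σ₃ hF₃ ⟨ht₃, hV⟩
    have hki₃ := (hF₃.reg .i rfl).trans hki
    refine (append_ends (i := G.n) (j := k) (c := G.hiBd k - G.r k) (k := k) hV
      ((hF₃.reg .n rfl).trans hn) hki₃ hki₃ rfl ?_).mono ?_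
    · simp [hki₃, (hF₃.arr .r rfl).trans hr,
        (hF₃.arr .hiBd rfl).trans ((hF.arr .hiBd rfl).trans hhib₂)]
    rintro t₄ σ₄ - ⟨ht₄, hW⟩
    rw [(hF.arr .hasLo rfl).trans hlo₂,
      (hF₃.arr .hasHi rfl).trans ((hF.arr .hasHi rfl).trans hhi₂)] at hW
    exact ⟨by omega, _, ⟨hW.m, hW.src, hW.dst, hW.wt⟩, hG'.step hk₀ hk rfl rfl⟩
  rintro t₃ σ₃ hF₃ ⟨ht₃, U, hU, hG'⟩
  have hn₃ : σ₃.reg .n = G.n := (hF₃.reg .n rfl).trans hn₂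
  have hd₃ : σ₃.arr .d = G.d := (hF₃.arr .d rfl).trans ((hF₂.arr .d rfl).trans hσ₁.d)
  have hl₃ : σ₃.reg .lcm = G.lcmDiv :=
    (hF₃.reg .lcm rfl).trans ((hF₂.reg .lcm rfl).trans hl₁)
  simp [hn₃, hl₃]
  refine ⟨by nlinarith, ⟨G.n + 1, U.m, U.src, U.dst, U.wt, Function.update G.d G.n G.lcmDiv⟩, ?_,
    hG'.reduces hG rfl rfl rfl rfl rfl rfl⟩
  constructor <;> simp [hU.m, hU.src, hU.dst, hU.wt, hd₃]

theorem solveGeneral_ends {propagate : Stmt} {cost : ℕ → ℕ → ℕ → ℕ}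
    (hc : Propagates propagate cost) (hwn : (solve propagate).writesReg .n = false)
    (hwr : (solve propagate).writesArr .r = false) {G : BoundedTable} (hG : G.Valid) {σ : Store}
    (hσ : G.Loaded σ) :
    Ends (solveGeneral propagate) σ fun t τ =>
      t ≤ 3 * overhead (G.n + 1) (G.m + G.numBounds G.n) G.lcmDiv +
        cost (G.n + 1) (G.m + G.numBounds G.n) G.lcmDiv ∧
      ((τ.reg .sat = 1 ∧ G.Solves (τ.arr .out)) ∨ (τ.reg .sat = 0 ∧ ¬ ∃ x, G.Solves x)) := by
  unfold solveGeneral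
  refine Ends.seq (makeSimple_ends hG hσ) ?_
  rintro t₁ σ₁ hF₁ ⟨ht₁, T, hT, hR⟩
  refine Ends.seq (solve_ends hc hR.valid hT) ?_
  rw [hR.n, hR.m, hR.lcmDiv]
  rintro t₂ σ₂ hF₂ ⟨ht₂, h⟩
  have hn₂ : σ₂.reg .n = G.n + 1 := by
    rw [hF₂.reg .n hwn, hT.n, hR.n]
    push_cast
    rfl
  have hr₂ : σ₂.arr .r = G.r := (hF₂.arr .r hwr).trans ((hF₁.arr .r rfl).trans hσ.r)
  have hcost : t₁ + G.n * 30 + 50 ≤ 2 * overhead (G.n + 1) (G.m + G.numBounds G.n) G.lcmDiv := by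
    have h₁ : G.n * (G.lcmDiv * 12 + 100) ≤ (G.n + 1) * (G.lcmDiv * 12 + 100) :=
      Nat.mul_le_mul_right _ (by omega)
    have h₂ : G.n * 100 ≤ G.n * (G.lcmDiv * 12 + 100) := Nat.mul_le_mul_left _ (by omega)
    unfold overhead
    omega
  refine Ends.ite (fun hs => ?_) (fun hs => ?_)
  · simp [Cond.Holds] at hs
    have hy := (h.resolve_right fun h => by omega).2
    simp only [Ends.seq_iff (s := .set _ _), Ends.set_iff]
    refine (Ends.forBelow 13 (fun k τ => τ.reg .sat = 1 ∧ ∀ i : ℤ, 0 ≤ i → i < k →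
      τ.arr .out i = G.restore (σ₂.arr .up) i) (N := G.n) (by simp [hn₂])
      (by decide) rfl rfl ⟨by simpa using hs, fun i h₀ h => absurd h₀ (by omega)⟩ ?_).mono ?_
    · rintro k τ hk₀ hk hF hki ⟨hsat, hI⟩
      have hn : τ.reg .n = G.n := by rw [hF.reg .n rfl]; simp [hn₂]
      have hr : τ.arr .r = G.r := by rw [hF.arr .r rfl]; simp [hr₂]
      have hup : τ.arr .up = σ₂.arr .up := by rw [hF.arr .up rfl]; simp
      simp [hki, hn, hr, hup, hsat]
      intro i hi₀ hi
      rcases eq_or_ne i k with rfl | hne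
      · simp [BoundedTable.restore]
      · simpa [hne] using hI i hi₀ (by omega)
    · rintro t τ - ⟨ht, hsat, hI⟩
      simp [Cond.cost]
      refine ⟨by omega, Or.inl ⟨hsat, ?_⟩⟩
      obtain ⟨h₁, h₂⟩ := hR.restore _ hy
      refine ⟨fun e h₀ he => ?_, fun i hi₀ hi => ?_⟩
      · rw [hI _ (hG.src_nonneg e h₀ he) (hG.src_lt e h₀ he),
          hI _ (hG.dst_nonneg e h₀ he) (hG.dst_lt e h₀ he)]
        exact h₁ e h₀ he
      · rw [hI i hi₀ hi]
        exact h₂ i hi₀ hi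
  · simp [Cond.Holds] at hs
    obtain ⟨h₁, h₂⟩ := h.resolve_left fun h => hs h.1
    simp [Cond.cost]
    exact ⟨by omega, Or.inr ⟨h₁, fun x hx => h₂ (hR.satisfiable ⟨x, hx⟩)⟩⟩

/-! ### Tables and systems over `Fin n` -/

/-- The extension of a vector by `0`. -/
def extend {n : ℕ} (v : Fin n → ℤ) (i : ℤ) : ℤ :=
  if h : 0 ≤ i ∧ i < n then v ⟨i.toNat, by omega⟩ else 0

@[simp] theorem extend_natCast {n : ℕ} (v : Fin n → ℤ) (i : Fin n) : extend v (i : ℕ) = v i := by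
  simp [extend]

theorem forall_fin {n : ℕ} {P : ℤ → Prop} :
    (∀ i : ℤ, 0 ≤ i → i < n → P i) ↔ ∀ i : Fin n, P (i : ℕ) := by
  constructor
  · exact fun h i => h _ (by positivity) (by exact_mod_cast i.2)
  · intro h i h₀ hi
    have := h ⟨i.toNat, by omega⟩
    simpa [h₀] using this

theorem sum_Ico_eq_sum_fin (n : ℕ) (f : ℤ → ℕ) :
    ∑ i ∈ Finset.Ico (0 : ℤ) n, f i = ∑ i : Fin n, f (i : ℕ) := by
  symm
  refine Finset.sum_bij (fun i _ => ((i : ℕ) : ℤ)) ?_ ?_ ?_ ?_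
  · intro i _
    simp
  · intro i _ j _ h
    exact Fin.ext (by exact_mod_cast h)
  · intro i hi
    rw [Finset.mem_Ico] at hi
    exact ⟨⟨i.toNat, by omega⟩, Finset.mem_univ _, by simp [hi.1]⟩
  · simp

/-- The table that the memory holds. -/
def tableOf (n m : ℕ) (σ : Store) : Table :=
  ⟨n, m, σ.arr .src, σ.arr .dst, σ.arr .wt, σ.arr .d⟩

/-- What an input memory says about `S`, in terms of the table that it holds. -/
theorem Input.exists_table {n : ℕ} {S : SDBM n} (hd : ∀ i, S.d i ≠ 0) {σ : Store}
    (h : Input S σ) : ∃ T : Table, T.Valid ∧ T.Loaded σ ∧ T.n = n ∧ T.m = S.E.card ∧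
      T.lcmDiv = S.lcmDiv ∧ (∀ i : Fin n, T.d (i : ℕ) = S.d i) ∧
      ∀ x : ℤ → ℤ, T.Feasible x ↔
        ∀ i j : Fin n, ∀ c : ℤ, (i, j, c) ∈ S.E → -x (i : ℕ) + x (j : ℕ) ≤ c := by
  obtain ⟨hn, hσd, L, hL, hLE, hm, hσ⟩ := h
  have hidx : ∀ e : ℤ, 0 ≤ e → e < L.length → ∃ i j : Fin n, ∃ c : ℤ, (i, j, c) ∈ L ∧
      σ.arr .src e = ((i : ℕ) : ℤ) ∧ σ.arr .dst e = ((j : ℕ) : ℤ) ∧ σ.arr .wt e = c := by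
    intro e h₀ he
    lift e to ℕ using h₀
    exact ⟨_, _, _, L.getElem_mem (by exact_mod_cast he), hσ e (by exact_mod_cast he)⟩
  refine ⟨tableOf n L.length σ, ⟨fun e h₀ he => ?_, fun e h₀ he => ?_, fun e h₀ he => ?_,
    fun e h₀ he => ?_, ?_⟩, ⟨hn, hm, rfl, rfl, rfl, rfl⟩, rfl, ?_, ?_, hσd, fun x => ⟨?_, ?_⟩⟩
  · obtain ⟨i, j, c, -, hi, -⟩ := hidx e h₀ he
    simp [tableOf, hi]
  · obtain ⟨i, j, c, -, hi, -⟩ := hidx e h₀ he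
    simp [tableOf, hi]
  · obtain ⟨i, j, c, -, -, hj, -⟩ := hidx e h₀ he
    simp [tableOf, hj]
  · obtain ⟨i, j, c, -, -, hj, -⟩ := hidx e h₀ he
    simp [tableOf, hj]
  · refine forall_fin.2 fun i => ?_
    exact (hσd i).trans_ne (hd i)
  · rw [← hLE, List.toFinset_card_of_nodup hL]
    rfl
  · unfold SDBM.lcmDiv
    refine Nat.dvd_antisymm ?_ (Finset.lcm_dvd fun i _ => ?_)
    · unfold Table.lcmDiv Table.lcmBelow
      refine Finset.lcm_dvd fun i hi => ?_
      rw [Finset.mem_Ico] at hi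
      revert i
      simp only [and_imp]
      refine forall_fin.2 fun i => ?_
      rw [show (tableOf n L.length σ).d (i : ℕ) = S.d i from hσd i]
      exact Finset.dvd_lcm (f := fun i => (S.d i).natAbs) (Finset.mem_univ i)
    · have h := (tableOf n L.length σ).dvd_lcmDiv (i := (i : ℕ)) (by positivity)
        (by exact_mod_cast i.2)
      rw [show (tableOf n L.length σ).d (i : ℕ) = S.d i from hσd i] at h
      exact Int.natAbs_dvd_natAbs.2 h
  · intro h i j c hc
    rw [← hLE, List.mem_toFinset, List.mem_iff_getElem] at hc
    obtain ⟨e, he, hec⟩ := hc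
    have h₁ := h e (by positivity) (by exact_mod_cast he)
    obtain ⟨h₂, h₃, h₄⟩ := hσ e he
    simp only [tableOf, h₂, h₃, h₄, hec] at h₁
    omega
  · intro h e h₀ he
    obtain ⟨i, j, c, hc, hi, hj, hw⟩ := hidx e h₀ he
    have := h i j c (by rw [← hLE]; exact List.mem_toFinset.2 hc)
    simp only [tableOf, hi, hj, hw]
    omega

theorem isSolution_iff_of_isSimple {n : ℕ} {S : SDBM n} (hS : S.IsSimple) {T : Table}
    (hn : T.n = n) (hd : ∀ i : Fin n, T.d (i : ℕ) = S.d i)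
    (hfeas : ∀ x : ℤ → ℤ, T.Feasible x ↔
      ∀ i j : Fin n, ∀ c : ℤ, (i, j, c) ∈ S.E → -x (i : ℕ) + x (j : ℕ) ≤ c) (x : ℤ → ℤ) :
    (S.toDBM.IsSolution (fun i => x (i : ℕ)) ↔ T.Feasible x) ∧
      (S.IsSolution (fun i => x (i : ℕ)) ↔ T.Solves x) := by
  obtain ⟨h₁, h₂, h₃⟩ := hS
  have h : S.toDBM.IsSolution (fun i => x (i : ℕ)) ↔ T.Feasible x := by
    simp [DBM.IsSolution, h₁, h₂, hfeas]
  refine ⟨h, ?_⟩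
  unfold SDBM.IsSolution Table.Solves
  rw [h, hn, forall_fin]
  simp [h₃, hd, Int.modEq_zero_iff_dvd]

theorem satisfiable_iff {n : ℕ} {S : SDBM n} {P : (ℤ → ℤ) → Prop}
    (h : ∀ x : ℤ → ℤ, S.IsSolution (fun i => x (i : ℕ)) ↔ P x) : S.Satisfiable ↔ ∃ x, P x := by
  constructor
  · rintro ⟨v, hv⟩
    exact ⟨extend v, (h _).1 (by simpa using hv)⟩
  · rintro ⟨x, hx⟩
    exact ⟨_, (h x).2 hx⟩

theorem solve_correct {propagate : Stmt} {cost : ℕ → ℕ → ℕ → ℕ} (hc : Propagates propagate cost)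
    {n : ℕ} {S : SDBM n} (hS : S.IsSimple) (hd : ∀ i, S.d i ≠ 0) {σ : Store} (hσ : Input S σ) :
    Ends (solve propagate) σ fun t τ => CorrectAnswer S .up τ ∧
      t ≤ overhead n S.E.card S.lcmDiv + cost n S.E.card S.lcmDiv := by
  obtain ⟨T, hT, hL, rfl, hm, hD, hTd, hfeas⟩ := hσ.exists_table hd
  have hiff := fun x => (isSolution_iff_of_isSimple hS rfl hTd hfeas x).2
  refine (solve_ends hc hT hL).mono ?_
  rintro t τ - ⟨ht, h⟩
  rw [hm, hD] at ht
  refine ⟨?_, ht⟩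
  rcases h with ⟨h₁, h₂⟩ | ⟨h₁, h₂⟩
  · exact Or.inl ⟨h₁, (hiff _).2 h₂⟩
  · exact Or.inr ⟨h₁, by rwa [satisfiable_iff hiff]⟩

theorem solveFrom_correct {propagate : Stmt} {cost : ℕ → ℕ → ℕ → ℕ}
    (hc : Propagates propagate cost) {n : ℕ} {S : SDBM n} (hS : S.IsSimple)
    (hd : ∀ i, S.d i ≠ 0) {σ : Store} (hσ : Input S σ) (hp : S.toDBM.IsSolution (vec n σ .p)) :
    Ends (solveFrom propagate) σ fun t τ => CorrectAnswer S .up τ ∧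
      (τ.reg .sat = 1 → ∀ i, |vec n τ .up i - vec n σ .p i| ≤ n * S.lcmDiv) ∧
      t ≤ overhead n S.E.card S.lcmDiv + cost n S.E.card S.lcmDiv := by
  obtain ⟨T, hT, hL, rfl, hm, hD, hTd, hfeas⟩ := hσ.exists_table hd
  have hiff := isSolution_iff_of_isSimple hS rfl hTd hfeas
  refine (solveFrom_ends hc hT hL ((hiff _).1.1 hp)).mono ?_
  rintro t τ - ⟨ht, h⟩
  rw [hm, hD] at ht
  have hcost : T.n * (S.lcmDiv * 12 + 100) + 30 ≤ overhead T.n S.E.card S.lcmDiv := by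
    unfold overhead
    omega
  rcases h with ⟨h₁, h₂, h₃⟩ | ⟨h₁, h₂⟩
  · exact ⟨Or.inl ⟨h₁, (hiff _).2.2 h₂⟩, fun _ i => by
      simpa [hD, vec] using forall_fin.1 h₃ i, by omega⟩
  · exact ⟨Or.inr ⟨h₁, by rwa [satisfiable_iff fun x => (hiff x).2]⟩, fun h => by omega, by omega⟩

theorem solveGeneral_correct {propagate : Stmt} {cost : ℕ → ℕ → ℕ → ℕ}
    (hc : Propagates propagate cost) (hwn : (solve propagate).writesReg .n = false)
    (hwr : (solve propagate).writesArr .r = false) {n : ℕ} {S : SDBM n}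
    (hd : ∀ i, S.d i ≠ 0) {σ : Store} (hσ : Input S σ) (hb : InputBounds S σ) :
    Ends (solveGeneral propagate) σ fun t τ => CorrectAnswer S .out τ ∧
      t ≤ 3 * overhead (n + 1) S.numIneqs S.lcmDiv + cost (n + 1) S.numIneqs S.lcmDiv := by
  obtain ⟨T, hT, hL, rfl, hm, hD, hTd, hfeas⟩ := hσ.exists_table hd
  obtain ⟨hr, hlo, hlob, hhi, hhib⟩ := hb
  let G : BoundedTable := ⟨T, σ.arr .r, σ.arr .hasLo, σ.arr .loBd, σ.arr .hasHi, σ.arr .hiBd⟩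
  have hlo' : ∀ i : Fin T.n, G.hasLo (i : ℕ) = 1 ↔ (S.lower i).isSome := fun i => by
    rw [show G.hasLo (i : ℕ) = _ from hlo i]
    split_ifs with h <;> simp [h]
  have hhi' : ∀ i : Fin T.n, G.hasHi (i : ℕ) = 1 ↔ (S.upper i).isSome := fun i => by
    rw [show G.hasHi (i : ℕ) = _ from hhi i]
    split_ifs with h <;> simp [h]
  have hnum : G.m + G.numBounds G.n = S.numIneqs := by
    unfold BoundedTable.numBounds DBM.numIneqs
    rw [sum_Ico_eq_sum_fin, Finset.sum_add_distrib, Finset.card_filter, Finset.card_filter,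
      ← add_assoc, show G.m = S.E.card from hm]
    simp only [hlo', hhi']
    congr!
  have hiff : ∀ x : ℤ → ℤ, S.IsSolution (fun i => x (i : ℕ)) ↔ G.Solves x := by
    intro x
    have h : (∀ i : ℤ, 0 ≤ i → i < G.n → G.WithinBounds i (x i) ∧ G.d i ∣ x i - G.r i) ↔
        ∀ i : Fin T.n, ((∀ l ∈ S.lower i, l ≤ x (i : ℕ)) ∧ ∀ u ∈ S.upper i, x (i : ℕ) ≤ u) ∧
          x (i : ℕ) ≡ S.r i [ZMOD S.d i] := by
      rw [forall_fin]
      refine forall_congr' fun i => and_congr (and_congr ?_ ?_) ?_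
      · rw [hlo']
        cases h : S.lower i with
        | none => simp
        | some l => simp [G, hlob i l h]
      · rw [hhi']
        cases h : S.upper i with
        | none => simp
        | some u => simp [G, hhib i u h]
      · rw [show G.d (i : ℕ) = S.d i from hTd i, show G.r (i : ℕ) = S.r i from hr i,
          Int.modEq_comm, Int.modEq_iff_dvd]
    unfold SDBM.IsSolution DBM.IsSolution BoundedTable.Solves
    rw [h, show G.Feasible x ↔ _ from hfeas x]
    simp only [forall_and]
    tauto
  refine (solveGeneral_ends hc hwn hwr (G := G) hT ⟨hL, rfl, rfl, rfl, rfl, rfl⟩).mono ?_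
  rintro t τ - ⟨ht, h⟩
  rw [hnum, show G.lcmDiv = S.lcmDiv from hD] at ht
  refine ⟨?_, ht⟩
  rcases h with ⟨h₁, h₂⟩ | ⟨h₁, h₂⟩
  · exact Or.inl ⟨h₁, (hiff _).2 h₂⟩
  · exact Or.inr ⟨h₁, by rwa [satisfiable_iff hiff]⟩

theorem _root_.SDBM.one_le_lcmDiv {n : ℕ} {S : SDBM n} (hd : ∀ i, S.d i ≠ 0) : 1 ≤ S.lcmDiv := by
  rw [Nat.one_le_iff_ne_zero, SDBM.lcmDiv, Ne, Finset.lcm_eq_zero_iff]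
  simpa using hd

theorem _root_.DBM.one_le_of_card {n : ℕ} {B : DBM n} (h : 1 ≤ B.E.card) : 1 ≤ n := by
  obtain ⟨⟨i, -⟩, -⟩ := Finset.card_pos.1 h
  exact Nat.one_le_iff_ne_zero.2 fun h => (h ▸ i).elim0

theorem _root_.DBM.one_le_of_numIneqs {n : ℕ} {B : DBM n} (h : 1 ≤ B.numIneqs) : 1 ≤ n := by
  rcases Nat.eq_zero_or_pos n with rfl | hn
  · simp [DBM.numIneqs] at h
    exact DBM.one_le_of_card (Finset.card_pos.2 h)
  · exact hn

/-- Adding a variable at most doubles the number of variables. -/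
theorem succ_mul_le {n m D : ℕ} (hn : 1 ≤ n) : (n + 1) * m * D ≤ 2 * (n * m * D) := by
  calc (n + 1) * m * D ≤ (2 * n) * m * D := by gcongr; omega
    _ = 2 * (n * m * D) := by ring

theorem succ_sq_mul_le {n m D : ℕ} (hn : 1 ≤ n) :
    (n + 1) ^ 2 * m * D ≤ 4 * (n ^ 2 * m * D) := by
  calc (n + 1) ^ 2 * m * D ≤ (2 * n) ^ 2 * m * D := by gcongr; omega
    _ = 4 * (n ^ 2 * m * D) := by ring

theorem mul_le_sq_mul {n m D : ℕ} (hn : 1 ≤ n) : n * m * D ≤ n ^ 2 * m * D := by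
  gcongr
  nlinarith

end SolveSDBM

open RAM SolveSDBM in
theorem mainTheorem1 :
    ∃ C : ℕ,
      -- simple systems: both versions of the algorithm, on every input and for all choices
      (∀ (n : ℕ) (S : SDBM n), S.IsSimple → (∀ i, S.d i ≠ 0) →
        ∀ σ : Store, Input S σ →
          (∃ (t : ℕ) (τ : Store), Exec (solve sweep) σ t τ ∧ CorrectAnswer S .up τ ∧
            (1 ≤ S.E.card → t ≤ C * (n ^ 2 * S.E.card * S.lcmDiv))) ∧
          (∃ (t : ℕ) (τ : Store), Exec (solve worklist) σ t τ ∧ CorrectAnswer S .up τ ∧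
            (1 ≤ S.E.card → t ≤ C * (n * S.E.card * S.lcmDiv))) ∧
          -- the same from an arbitrary integral solution `p` of the inequalities
          (S.toDBM.IsSolution (vec n σ .p) →
            (∃ (t : ℕ) (τ : Store), Exec (solveFrom sweep) σ t τ ∧ CorrectAnswer S .up τ ∧
              (τ.reg .sat = 1 → ∀ i, |vec n τ .up i - vec n σ .p i| ≤ n * S.lcmDiv) ∧
              (1 ≤ S.E.card → t ≤ C * (n ^ 2 * S.E.card * S.lcmDiv))) ∧
            (∃ (t : ℕ) (τ : Store), Exec (solveFrom worklist) σ t τ ∧ CorrectAnswer S .up τ ∧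
              (τ.reg .sat = 1 → ∀ i, |vec n τ .up i - vec n σ .p i| ≤ n * S.lcmDiv) ∧
              (1 ≤ S.E.card → t ≤ C * (n * S.E.card * S.lcmDiv))))) ∧
      -- arbitrary systems, with remainders and variable bounds
      (∀ (n : ℕ) (S : SDBM n), (∀ i, S.d i ≠ 0) →
        ∀ σ : Store, Input S σ → InputBounds S σ →
          (∃ (t : ℕ) (τ : Store), Exec (solveGeneral sweep) σ t τ ∧ CorrectAnswer S .out τ ∧
            (1 ≤ S.numIneqs → t ≤ C * (n ^ 2 * S.numIneqs * S.lcmDiv))) ∧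
          (∃ (t : ℕ) (τ : Store), Exec (solveGeneral worklist) σ t τ ∧ CorrectAnswer S .out τ ∧
            (1 ≤ S.numIneqs → t ≤ C * (n * S.numIneqs * S.lcmDiv)))) := by
  refine ⟨10000, fun n S hS hd σ hσ => ?_, fun n S hd σ hσ hb => ?_⟩
  · have hD := SDBM.one_le_lcmDiv hd
    have hsweep : 1 ≤ S.E.card → overhead n S.E.card S.lcmDiv + sweepCost n S.E.card S.lcmDiv ≤
        10000 * (n ^ 2 * S.E.card * S.lcmDiv) := fun hm => by
      have hn := DBM.one_le_of_card hm
      have h₁ := overhead_le hn hm hD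
      have h₂ := sweepCost_le hn hm hD
      have h₃ := mul_le_sq_mul (m := S.E.card) (D := S.lcmDiv) hn
      omega
    have hwork : 1 ≤ S.E.card → overhead n S.E.card S.lcmDiv + worklistCost n S.E.card S.lcmDiv ≤
        10000 * (n * S.E.card * S.lcmDiv) := fun hm => by
      have hn := DBM.one_le_of_card hm
      have h₁ := overhead_le hn hm hD
      have h₂ := worklistCost_le hn hm hD
      omega
    refine ⟨(solve_correct sweep_propagates hS hd hσ).mono ?_,
      (solve_correct worklist_propagates hS hd hσ).mono ?_, fun hp =>
      ⟨(solveFrom_correct sweep_propagates hS hd hσ hp).mono ?_,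
      (solveFrom_correct worklist_propagates hS hd hσ hp).mono ?_⟩⟩
    · exact fun t τ _ h => ⟨h.1, fun hm => h.2.trans (hsweep hm)⟩
    · exact fun t τ _ h => ⟨h.1, fun hm => h.2.trans (hwork hm)⟩
    · exact fun t τ _ h => ⟨h.1, h.2.1, fun hm => h.2.2.trans (hsweep hm)⟩
    · exact fun t τ _ h => ⟨h.1, h.2.1, fun hm => h.2.2.trans (hwork hm)⟩
  · have hD := SDBM.one_le_lcmDiv hd
    refine ⟨(solveGeneral_correct sweep_propagates rfl rfl hd hσ hb).mono ?_,
      (solveGeneral_correct worklist_propagates rfl rfl hd hσ hb).mono ?_⟩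
    · refine fun t τ _ h => ⟨h.1, fun hm => h.2.trans ?_⟩
      have hn := DBM.one_le_of_numIneqs hm
      have h₁ := overhead_le (n := n + 1) (by omega) hm hD
      have h₂ := sweepCost_le (n := n + 1) (by omega) hm hD
      have h₃ := succ_mul_le (m := S.numIneqs) (D := S.lcmDiv) hn
      have h₄ := succ_sq_mul_le (m := S.numIneqs) (D := S.lcmDiv) hn
      have h₅ := mul_le_sq_mul (m := S.numIneqs) (D := S.lcmDiv) hn
      omega
    · refine fun t τ _ h => ⟨h.1, fun hm => h.2.trans ?_⟩
      have hn := DBM.one_le_of_numIneqs hm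
      have h₁ := overhead_le (n := n + 1) (by omega) hm hD
      have h₂ := worklistCost_le (n := n + 1) (by omega) hm hD
      have h₃ := succ_mul_le (m := S.numIneqs) (D := S.lcmDiv) hn
      omega
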